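/- **Setting.** $\mathcal{EL}^+_\bot$ concepts are $E ::= A \mid \top \mid \bot \mid E \sqcap E \mid \exists r.E$ with $A\in N_C$, $r\in N_R$. A ranked knowledge base $K=\langle \mathcal T_{strict},\mathcal T_{C_1},\dots,\mathcal T_{C_k},\mathcal A\rangle$ over a finite set $\mathcal C=\{C_1,\dots,C_k\}$ consists of finitely many strict concept and role inclusions, an ABox $\mathcal A$, and for each $C_j$ a finite set $\mathcal T_{C_j}$ of defeasible inclusions $\mathbf T(C_j)\sqsubseteq B$ with ranks in $\mathbb N$. $K$ is *normalized* if all strict inclusions have one of the forms $\top\sqsubseteq A$, $A\sqsubseteq\bot$, $A\sqsubseteq B$, $A\sqcap B\sqsubseteq A'$, $\exists r.A\sqsubseteq B$, $A\sqsubseteq\exists r.B$, $r\sqsubseteq t$, $r\circ s\sqsubseteq t$, and all assertions and defeasible inclusions involve only concept names as concepts. In an interpretation $I$ with domain $\Delta$, $x$ satisfies $\mathbf T(C_j)\sqsubseteq B$ if $x\notin C_j^I$ or $x\in B^I$. Put $x\le_{C_j}y$ if, for every rank, $x$ and $y$ satisfy equally many defeasible inclusions of $\mathcal T_{C_j}$,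 or $x$ satisfies more at the highest rank where the numbers differ; $<_{C_j}$ is the strict part. $C_h\succ C_j$ means $\mathcal T_{strict}\models C_h\sqsubseteq C_j$ and $\mathcal T_{strict}\not\models C_j\sqsubseteq C_h$. Globally, $x<y$ iff $x<_{C_i}y$ for some $C_i\in\mathcal C$ and, for all $C_j\in\mathcal C$, $x\le_{C_j}y$ or $x<_{C_h}y$ for some $C_h\succ C_j$. A *cw$^m$-model* of $K$ is a finite model of $\mathcal T_{strict}$ and $\mathcal A$ with these relations, where $(\mathbf T(C))^I=\min_<(C^I)$. It is *$\mathbf T$-compliant* if each $C_h\in\mathcal C$ with $C_h^I\ne\emptyset$ has an instance satisfying all of $\mathcal T_{C_h}$. It is *canonical* if each set of concepts occurring in $K$ and complements $\overline E$ of such concepts that is consistent with $\mathcal T_{strict}$ (where $\overline E$ is a new concept name constrained by $E\sqcap\overline E\sqsubseteq\bot$) is realized by a domain element. $K\models_{cw^m}\mathbf T(C)\sqsubseteq D$ means that $\mathbf T(C)\sqsubseteq D$ holds in all canonical, $\mathbf T$-compliant cw$^m$-models of $K$. $\Pi(K,C,D)$ is the answer set program made of: the Datalog input translation of $K$; the rules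 of the materialization calculus for $\mathcal{EL}^+_\bot$ for instance checking (with the constraint that no individual is an instance of a concept declared empty) and for subclass checking; a rule deriving $\mathit{morespec}$, that is $\succ$; the rules (a) $\{\mathit{inst}(aux_C,B)\}\leftarrow \mathit{dcls}(C_i),\mathit{inst}(aux_C,C_i),\mathit{tprop}(C_i,B)$, (b) $\mathit{inst}(y,C_i)\leftarrow \mathit{auxtc}(y,C_i),\mathit{inst}(x,C_i)$, (c) $\mathit{typ}(y,C_i)\leftarrow \mathit{auxtc}(y,C_i),\mathit{inst}(y,C_i)$, (d) $\mathit{inst}(y,B)\leftarrow \mathit{subTyp}(C_i,B,n),\mathit{typ}(y,C_i)$; the facts $\mathit{auxtc}(aux_{C_i},C_i)$; normalized axioms defining names for the complex subconcepts of $C$ and $D$ and a new name $A_C$ equivalent to $C$; and the facts $\mathit{auxtc}(aux_C,A_C)$, $\mathit{nom}(aux_C)$, $\mathit{inst}(aux_C,A_C)$. An answer set $S$ is *preferred* (according to the asprin preference program $\mathit{Pref}$) if no answer set $S'$ is better, where $S'$ is better than $S$ if $\mathit{Pref}$ derives that $aux_C$ in $S'$ is globally preferred to $aux_C$ in $S$: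 the definitions of $\le_{C_j}$, $<_{C_j}$ and $<$ are applied, counting $\mathbf T(C_i)\sqsubseteq B$ as satisfied in $S$ if $\mathit{inst}(aux_C,C_i)\notin S$ or $\mathit{inst}(aux_C,B)\in S$. **Statement.** Let $K$ be a normalized ranked knowledge base and $C,D$ be $\mathcal{EL}^+_\bot$ concepts. (1) Suppose that $C$ is built with $\sqcap,\top,\bot$ from concepts occurring in $K$. If some canonical, $\mathbf T$-compliant cw$^m$-model of $K$ falsifies $\mathbf T(C)\sqsubseteq D$, then some preferred answer set $S$ of $\Pi(K,C,D)$ has $\mathit{inst}(aux_C,D)\notin S$. (2) Suppose that the defeasible inclusions of $K$ do not conflict with the strict ones: each $C_h\in\mathcal C$ that is satisfiable w.r.t. $\mathcal T_{strict}$ has, in some interpretation satisfying $\mathcal T_{strict}$, an instance satisfying all of $\mathcal T_{C_h}$. If some preferred answer set $S$ of $\Pi(K,C,D)$ has $\mathit{inst}(aux_C,D)\notin S$, then some canonical, $\mathbf T$-compliant cw$^m$-model of $K$ falsifies $\mathbf T(C)\sqsubseteq D$. (3) Hence, under both assumptions, $K\models_{cw^m}\mathbf T(C)\sqsubseteq D$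 iff $\mathit{inst}(aux_C,D)$ belongs to every preferred answer set of $\Pi(K,C,D)$. -/

import Mathlib

namespace CwM

/-! ## The description logic: syntax and semantics -/

/-- Concepts over concept names `NC` and role names `NR`. -/
inductive Concept (NC NR : Type) : Type
  | atom (A : NC)
  | top
  | bot
  | inter (E F : Concept NC NR)
  | ex (r : NR) (E : Concept NC NR)

/-- Strict axioms: concept inclusions `C ⊑ D` and role inclusions `r ∘ r₁ ∘ … ∘ rₙ ⊑ t`
(the chain on the left is the non-empty list `r :: rs`). -/
inductive Inclusion (NC NR : Type) : Type
  | concept (C D : Concept NC NR)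
  | role (r : NR) (rs : List NR) (t : NR)

/-- Assertions `C(a)` and `r(a,b)`. -/
inductive Assertion (NC NR NI : Type) : Type
  | concept (C : Concept NC NR) (a : NI)
  | role (r : NR) (a b : NI)

/-- Interpretation functions over the domain `Δ` (domains are required to be non-empty wherever
interpretations are quantified over). -/
structure Interpretation (NC NR NI Δ : Type) where
  con : NC → Set Δ
  role : NR → Δ → Δ → Prop
  ind : NI → Δ

section Semantics

variable {NC NR NI Δ : Type}

/-- Extension of the interpretation function to complex concepts. -/
def Interpretation.ext (I : Interpretation NC NR NI Δ) : Concept NC NR → Set Δ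
  | .atom A => I.con A
  | .top => Set.univ
  | .bot => ∅
  | .inter E F => I.ext E ∩ I.ext F
  | .ex r E => {x | ∃ y, I.role r x y ∧ y ∈ I.ext E}

/-- The composition of the interpretations of the roles `r :: rs`. -/
def Interpretation.chain (I : Interpretation NC NR NI Δ) : NR → List NR → Δ → Δ → Prop
  | r, [], x, y => I.role r x y
  | r, s :: rs, x, y => ∃ z, I.role r x z ∧ I.chain s rs z y

def Interpretation.SatInclusion (I : Interpretation NC NR NI Δ) : Inclusion NC NR → Prop
  | .concept C D => I.ext C ⊆ I.ext D
  | .role r rs t => ∀ x y, I.chain r rs x y → I.role t x y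

def Interpretation.SatAssertion (I : Interpretation NC NR NI Δ) : Assertion NC NR NI → Prop
  | .concept C a => I.ind a ∈ I.ext C
  | .role r a b => I.role r (I.ind a) (I.ind b)

def Interpretation.SatTBox (I : Interpretation NC NR NI Δ) (T : Set (Inclusion NC NR)) : Prop :=
  ∀ α ∈ T, I.SatInclusion α

/-- `T ⊨ C ⊑ D`. -/
def Entails (NI : Type) (T : Set (Inclusion NC NR)) (C D : Concept NC NR) : Prop :=
  ∀ (Δ : Type) [Nonempty Δ] (I : Interpretation NC NR NI Δ), I.SatTBox T → I.ext C ⊆ I.ext D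

/-- The subconcepts of a concept, itself included. -/
def Concept.subs : Concept NC NR → Set (Concept NC NR)
  | .atom A => {.atom A}
  | .top => {.top}
  | .bot => {.bot}
  | .inter E F => {.inter E F} ∪ (E.subs ∪ F.subs)
  | .ex r E => {.ex r E} ∪ E.subs

/-- `C` is built with `⊓`, `⊤`, `⊥` from concepts of the set `X`. -/
def Concept.BuiltFrom (X : Set (Concept NC NR)) : Concept NC NR → Prop
  | .atom A => .atom A ∈ X
  | .top => True
  | .bot => True
  | .inter E F => E.BuiltFrom X ∧ F.BuiltFrom X
  | .ex r E => .ex r E ∈ X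

/-- Renaming of concept names. -/
def Concept.map {NC' : Type} (f : NC → NC') : Concept NC NR → Concept NC' NR
  | .atom A => .atom (f A)
  | .top => .top
  | .bot => .bot
  | .inter E F => .inter (E.map f) (F.map f)
  | .ex r E => .ex r (E.map f)

def Inclusion.map {NC' : Type} (f : NC → NC') : Inclusion NC NR → Inclusion NC' NR
  | .concept C D => .concept (C.map f) (D.map f)
  | .role r rs t => .role r rs t

end Semantics

/-! ## Ranked knowledge bases -/

/-- A ranked knowledge base over the finite set `dist` of distinguished concepts. For `C ∈ dist`,
`(D, n) ∈ typ C` says that `T(C) ⊑ D` is a defeasible inclusion of rank `n`; the values of `typ`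
outside `dist` play no role. -/
structure RankedKB (NC NR NI : Type) where
  strict : Finset (Inclusion NC NR)
  dist : Finset (Concept NC NR)
  typ : Concept NC NR → Finset (Concept NC NR × ℕ)
  abox : Finset (Assertion NC NR NI)

section KB

variable {NC NR NI Δ : Type}

/-- Strict axioms in normal form. -/
inductive Inclusion.Normal : Inclusion NC NR → Prop
  | top (C : NC) : Normal (.concept .top (.atom C))
  | bot (A : NC) : Normal (.concept (.atom A) .bot)
  | sub (A C : NC) : Normal (.concept (.atom A) (.atom C))
  | conj (A B C : NC) : Normal (.concept (.inter (.atom A) (.atom B)) (.atom C))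
  | exLeft (r : NR) (A C : NC) : Normal (.concept (.ex r (.atom A)) (.atom C))
  | exRight (A : NC) (r : NR) (B : NC) : Normal (.concept (.atom A) (.ex r (.atom B)))
  | role (r t : NR) : Normal (.role r [] t)
  | chain (r s t : NR) : Normal (.role r [s] t)

/-- Assertions in normal form. -/
inductive Assertion.Normal : Assertion NC NR NI → Prop
  | concept (A : NC) (a : NI) : Normal (.concept (.atom A) a)
  | role (r : NR) (a b : NI) : Normal (.role r a b)

structure RankedKB.Normalized (K : RankedKB NC NR NI) : Prop where
  strict : ∀ α ∈ K.strict, α.Normal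
  abox : ∀ α ∈ K.abox, α.Normal
  dist : ∀ C ∈ K.dist, ∃ A, C = .atom A
  typ : ∀ C ∈ K.dist, ∀ p ∈ K.typ C, ∃ B, p.1 = .atom B

/-- The concepts occurring in `K`. -/
def RankedKB.occurring (K : RankedKB NC NR NI) : Set (Concept NC NR) :=
  {E | (∃ C D, Inclusion.concept C D ∈ K.strict ∧ (E ∈ C.subs ∨ E ∈ D.subs)) ∨
    (∃ C ∈ K.dist, E ∈ C.subs ∨ ∃ p ∈ K.typ C, E ∈ p.1.subs) ∨
    (∃ C a, Assertion.concept C a ∈ K.abox ∧ E ∈ C.subs)}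

/-- `x` satisfies the defeasible inclusion `T(C) ⊑ D` in `I`. -/
def Interpretation.SatDefault (I : Interpretation NC NR NI Δ) (C D : Concept NC NR) (x : Δ) :
    Prop :=
  x ∉ I.ext C ∨ x ∈ I.ext D

/-- The number of defeasible inclusions of rank `l` for `C` that are satisfied by `x`. -/
noncomputable def RankedKB.numSat (K : RankedKB NC NR NI) (I : Interpretation NC NR NI Δ)
    (C : Concept NC NR) (l : ℕ) (x : Δ) : ℕ :=
  {D | (D, l) ∈ K.typ C ∧ I.SatDefault C D x}.ncard

/-- The preference relation `x ≤_C y` associated with the ranked TBox of `C` in `I`. -/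
def RankedKB.prefLE (K : RankedKB NC NR NI) (I : Interpretation NC NR NI Δ)
    (C : Concept NC NR) (x y : Δ) : Prop :=
  (∀ l, K.numSat I C l x = K.numSat I C l y) ∨
    ∃ l, K.numSat I C l y < K.numSat I C l x ∧
      ∀ h, l < h → K.numSat I C h x = K.numSat I C h y

/-- The strict preference relation `x <_C y`. -/
def RankedKB.prefLT (K : RankedKB NC NR NI) (I : Interpretation NC NR NI Δ)
    (C : Concept NC NR) (x y : Δ) : Prop :=
  K.prefLE I C x y ∧ ¬ K.prefLE I C y x

/-- A concept `E` (`(E, true)`) or its complement (`(E, false)`), as a concept over the signature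
extended with a new concept name for the complement of each concept. -/
def litConcept (p : Concept NC NR × Bool) : Concept (NC ⊕ Concept NC NR) NR :=
  if p.2 then p.1.map Sum.inl else .atom (Sum.inr p.1)

/-- Strict inclusions of `K` together with `E ⊓ Ē ⊑ ⊥` for each concept `E` occurring in `K`. -/
def RankedKB.constrTBox (K : RankedKB NC NR NI) : Set (Inclusion (NC ⊕ Concept NC NR) NR) :=
  {β | ∃ α ∈ K.strict, β = α.map Sum.inl} ∪
    {β | ∃ E ∈ K.occurring, β = .concept (.inter (litConcept (E, true)) (litConcept (E, false))) .bot}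

/-- Consistency with `K` of a finite set of concepts and complements of concepts. -/
def RankedKB.ConsistentWith (K : RankedKB NC NR NI) (L : List (Concept NC NR × Bool)) : Prop :=
  ¬ Entails NI K.constrTBox (L.foldr (fun p E => .inter (litConcept p) E) .top) .bot

def RankedKB.IsCanonical (K : RankedKB NC NR NI) (I : Interpretation NC NR NI Δ) : Prop :=
  I.SatTBox K.strict ∧
    ∀ L : List (Concept NC NR × Bool), (∀ p ∈ L, p.1 ∈ K.occurring) → K.ConsistentWith L →
      ∃ x : Δ, ∀ p ∈ L, (p.2 = true → x ∈ I.ext p.1) ∧ (p.2 = false → x ∉ I.ext p.1)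

/-- `x` is an instance of `C` satisfying all the defeasible inclusions for `C`. -/
def RankedKB.IsPrototype (K : RankedKB NC NR NI) (I : Interpretation NC NR NI Δ)
    (C : Concept NC NR) (x : Δ) : Prop :=
  x ∈ I.ext C ∧ ∀ p ∈ K.typ C, I.SatDefault C p.1 x

def RankedKB.IsTCompliant (K : RankedKB NC NR NI) (I : Interpretation NC NR NI Δ) : Prop :=
  I.SatTBox K.strict ∧ ∀ C ∈ K.dist, (I.ext C).Nonempty → ∃ x, K.IsPrototype I C x

/-- The defeasible inclusions do not conflict with the strict ones: a distinguished concept that is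
satisfiable with respect to the strict inclusions has, in some interpretation satisfying them, an
instance that satisfies all its defeasible inclusions. -/
def RankedKB.NoConflict (K : RankedKB NC NR NI) : Prop :=
  ∀ C ∈ K.dist, ¬ Entails NI (K.strict : Set (Inclusion NC NR)) C .bot →
    ∃ (Δ : Type) (_ : Nonempty Δ) (I : Interpretation NC NR NI Δ),
      I.SatTBox K.strict ∧ ∃ x, K.IsPrototype I C x

/-- Specificity `C ≻ D`. -/
def RankedKB.MoreSpecific (K : RankedKB NC NR NI) (C D : Concept NC NR) : Prop :=
  Entails NI (K.strict : Set (Inclusion NC NR)) C D ∧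
    ¬ Entails NI (K.strict : Set (Inclusion NC NR)) D C

/-- Concept-wise multipreference interpretations over the distinguished concepts of `K`. As the
relations `<_C` are modular, `x ≤_C y` is `¬ y <_C x`. -/
structure CwmInterpretation (K : RankedKB NC NR NI) (Δ : Type) where
  interp : Interpretation NC NR NI Δ
  ltC : Concept NC NR → Δ → Δ → Prop
  lt : Δ → Δ → Prop
  irrefl : ∀ C ∈ K.dist, ∀ x, ¬ ltC C x x
  trans : ∀ C ∈ K.dist, ∀ x y z, ltC C x y → ltC C y z → ltC C x z
  wf : ∀ C ∈ K.dist, WellFounded (ltC C)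
  modular : ∀ C ∈ K.dist, ∀ x y z, ltC C x y → ltC C x z ∨ ltC C z y
  lt_iff : ∀ x y, lt x y ↔
    (∃ C ∈ K.dist, ltC C x y) ∧
      ∀ C ∈ K.dist, ¬ ltC C y x ∨ ∃ H ∈ K.dist, K.MoreSpecific H C ∧ ltC H x y

/-- The interpretation of `T(C)`: the `<`-minimal instances of `C`. -/
def CwmInterpretation.typical {K : RankedKB NC NR NI} (M : CwmInterpretation K Δ)
    (C : Concept NC NR) : Set Δ :=
  {u | u ∈ M.interp.ext C ∧ ¬ ∃ z ∈ M.interp.ext C, M.lt z u}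

/-- `M` satisfies `T(C) ⊑ D`. -/
def CwmInterpretation.SatTyp {K : RankedKB NC NR NI} (M : CwmInterpretation K Δ)
    (C D : Concept NC NR) : Prop :=
  M.typical C ⊆ M.interp.ext D

/-- `M` is a concept-wise multipreference model of `K`. -/
structure CwmInterpretation.IsModel {K : RankedKB NC NR NI} (M : CwmInterpretation K Δ) :
    Prop where
  pref : ∀ C ∈ K.dist, ∀ x y, M.ltC C x y ↔ K.prefLT M.interp C x y
  strict : M.interp.SatTBox K.strict
  abox : ∀ α ∈ K.abox, M.interp.SatAssertion α

/-- `M` is a canonical and `T`-compliant concept-wise multipreference model of `K`. -/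
structure CwmInterpretation.IsCanonicalTCompliantModel {K : RankedKB NC NR NI}
    (M : CwmInterpretation K Δ) : Prop where
  model : M.IsModel
  canonical : K.IsCanonical M.interp
  compliant : K.IsTCompliant M.interp

/-- Entailment of `T(C) ⊑ D` from `K` under the (finite) concept-wise multipreference semantics. -/
def RankedKB.CwmEntails (K : RankedKB NC NR NI) (C D : Concept NC NR) : Prop :=
  ∀ (Δ : Type) [Finite Δ] [Nonempty Δ] (M : CwmInterpretation K Δ),
    M.IsCanonicalTCompliantModel → M.SatTyp C D

end KB

/-! ## Ground logic programs and answer sets -/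

/-- Heads of rules: an atom `a`, a choice `{a}`, or empty (integrity constraints). -/
inductive Head (α : Type) : Type
  | atom (a : α)
  | choice (a : α)
  | none

/-- A ground rule `head ← pos, not neg`. -/
structure Rule (α : Type) where
  head : Head α
  pos : List α
  neg : List α

def Rule.fact {α : Type} (a : α) : Rule α := ⟨.atom a, [], []⟩

def Rule.definite {α : Type} (a : α) (body : List α) : Rule α := ⟨.atom a, body, []⟩

section ASP

variable {α : Type}

/-- The Gelfond-Lifschitz reduct, a set of definite rules; a choice rule `{a} ← B` contributes the
rule `a ← B` when `a ∈ S`. -/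
def reduct (P : Set (Rule α)) (S : Set α) : Set (α × List α) :=
  {d | ∃ ρ ∈ P, (∀ b ∈ ρ.neg, b ∉ S) ∧ d.2 = ρ.pos ∧
    (ρ.head = .atom d.1 ∨ (ρ.head = .choice d.1 ∧ d.1 ∈ S))}

def ClosedUnder (Q : Set (α × List α)) (X : Set α) : Prop :=
  ∀ d ∈ Q, (∀ b ∈ d.2, b ∈ X) → d.1 ∈ X

/-- `S` is the least model of its reduct and violates no constraint. -/
def IsAnswerSet (P : Set (Rule α)) (S : Set α) : Prop :=
  IsLeast {X | ClosedUnder (reduct P S) X} S ∧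
    ∀ ρ ∈ P, ρ.head = .none → ¬ ((∀ b ∈ ρ.pos, b ∈ S) ∧ ∀ b ∈ ρ.neg, b ∉ S)

end ASP

/-! ## The base program -/

/-- Constants of the base program. -/
inductive Const (NC NR NI : Type) : Type
  /-- individual names -/
  | ind (a : NI)
  /-- concept names -/
  | cls (A : NC)
  /-- new concept names for complex concepts of the query -/
  | defn (E : Concept NC NR)
  /-- new concept name for the left-hand side of the query -/
  | qcls
  /-- auxiliary constant for an inclusion of `E` (or its name) in `∃ r. F` -/
  | wit (E : Concept NC NR) (r : NR) (F : Concept NC NR)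
  /-- `aux_A`, for a distinguished concept name `A` -/
  | typAux (A : NC)
  /-- `aux_C`, for the left-hand side `C` of the query -/
  | auxC

/-- Ground atoms of the base program. -/
inductive Atom (NC NR NI : Type) : Type
  | nom (c : Const NC NR NI)
  | cls (c : Const NC NR NI)
  | rol (r : NR)
  | top (c : Const NC NR NI)
  | bot (c : Const NC NR NI)
  | subClass (c d : Const NC NR NI)
  | subConj (c d e : Const NC NR NI)
  | subEx (r : NR) (c d : Const NC NR NI)
  | supEx (c : Const NC NR NI) (r : NR) (d e : Const NC NR NI)
  | subRole (r t : NR)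
  | subRChain (r s t : NR)
  | subTyp (c d : Const NC NR NI) (n : ℕ)
  | dcls (c : Const NC NR NI)
  | tprop (c d : Const NC NR NI)
  | validrank (c : Const NC NR NI) (n : ℕ)
  | auxtc (c d : Const NC NR NI)
  | inst (c d : Const NC NR NI)
  | triple (c : Const NC NR NI) (r : NR) (d : Const NC NR NI)
  | instSc (c d q : Const NC NR NI)
  | tripleSc (c : Const NC NR NI) (r : NR) (d q : Const NC NR NI)
  | typ (c d : Const NC NR NI)
  | morespec (c d : Const NC NR NI)

section Program

variable {NC NR NI : Type}

/-- The concept name standing for a concept of the query: a concept name stands for itself, a complex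
concept is given a new name. -/
def nameOf : Concept NC NR → Const NC NR NI
  | .atom A => .cls A
  | E => .defn E

/-- Input translation of `K`. -/
inductive KBFact (K : RankedKB NC NR NI) : Atom NC NR NI → Prop
  | nom (a : NI) : KBFact K (.nom (.ind a))
  | cls (A : NC) : KBFact K (.cls (.cls A))
  | rol (r : NR) : KBFact K (.rol r)
  | assertC (A : NC) (a : NI) : .concept (.atom A) a ∈ K.abox →
      KBFact K (.subClass (.ind a) (.cls A))
  | assertR (r : NR) (a b : NI) : .role r a b ∈ K.abox →
      KBFact K (.supEx (.ind a) r (.ind b) (.ind b))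
  | top (C : NC) : .concept .top (.atom C) ∈ K.strict → KBFact K (.top (.cls C))
  | bot (A : NC) : .concept (.atom A) .bot ∈ K.strict → KBFact K (.bot (.cls A))
  | sub (A C : NC) : .concept (.atom A) (.atom C) ∈ K.strict →
      KBFact K (.subClass (.cls A) (.cls C))
  | conj (A B C : NC) : .concept (.inter (.atom A) (.atom B)) (.atom C) ∈ K.strict →
      KBFact K (.subConj (.cls A) (.cls B) (.cls C))
  | exLeft (r : NR) (A C : NC) : .concept (.ex r (.atom A)) (.atom C) ∈ K.strict →
      KBFact K (.subEx r (.cls A) (.cls C))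
  | exRight (A : NC) (r : NR) (B : NC) : .concept (.atom A) (.ex r (.atom B)) ∈ K.strict →
      KBFact K (.supEx (.cls A) r (.cls B) (.wit (.atom A) r (.atom B)))
  | role (r t : NR) : .role r [] t ∈ K.strict → KBFact K (.subRole r t)
  | chain (r s t : NR) : .role r [s] t ∈ K.strict → KBFact K (.subRChain r s t)
  | subTyp (A B : NC) (n : ℕ) : .atom A ∈ K.dist → (.atom B, n) ∈ K.typ (.atom A) →
      KBFact K (.subTyp (.cls A) (.cls B) n)
  | auxtc (A : NC) : .atom A ∈ K.dist → KBFact K (.auxtc (.typAux A) (.cls A))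

/-- `Π_K`: the input translation and the definitions of distinguished concepts, typical properties
and valid ranks. -/
inductive KBRule (K : RankedKB NC NR NI) : Rule (Atom NC NR NI) → Prop
  | fact (a : Atom NC NR NI) : KBFact K a → KBRule K (.fact a)
  | dcls (c d : Const NC NR NI) (n : ℕ) : KBRule K (.definite (.dcls c) [.subTyp c d n])
  | tprop (c d : Const NC NR NI) (n : ℕ) : KBRule K (.definite (.tprop c d) [.subTyp c d n])
  | validrank (c d : Const NC NR NI) (n : ℕ) :
      KBRule K (.definite (.validrank c n) [.subTyp c d n])

/-- The rules of the materialization calculus, for a predicate `i` of instances and a predicate `t`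
of triples; `g` is added to the body of the first rule. -/
inductive CalcRule (g : List (Atom NC NR NI))
    (i : Const NC NR NI → Const NC NR NI → Atom NC NR NI)
    (t : Const NC NR NI → NR → Const NC NR NI → Atom NC NR NI) : Rule (Atom NC NR NI) → Prop
  | r1 (x : Const NC NR NI) : CalcRule g i t (.definite (i x x) (.nom x :: g))
  | r3 (x z z' : Const NC NR NI) : CalcRule g i t (.definite (i x z) [.top z, i x z'])
  | r4 (x y z u z' : Const NC NR NI) :
      CalcRule g i t (.definite (i x y) [.bot z, i u z, i x z', .cls y])
  | r5 (x y z : Const NC NR NI) : CalcRule g i t (.definite (i x z) [.subClass y z, i x y])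
  | r6 (x y₁ y₂ z : Const NC NR NI) :
      CalcRule g i t (.definite (i x z) [.subConj y₁ y₂ z, i x y₁, i x y₂])
  | r7 (x x' y z : Const NC NR NI) (v : NR) :
      CalcRule g i t (.definite (i x z) [.subEx v y z, t x v x', i x' y])
  | r9 (x x' y z : Const NC NR NI) (v : NR) :
      CalcRule g i t (.definite (t x v x') [.supEx y v z x', i x y])
  | r10 (x x' y z : Const NC NR NI) (v : NR) :
      CalcRule g i t (.definite (i x' z) [.supEx y v z x', i x y])
  | r13 (x x' : Const NC NR NI) (v w : NR) :
      CalcRule g i t (.definite (t x w x') [.subRole v w, t x v x'])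
  | r15 (x x' x'' : Const NC NR NI) (u v w : NR) :
      CalcRule g i t (.definite (t x w x'') [.subRChain u v w, t x u x', t x' v x''])
  | r27 (x y z : Const NC NR NI) : CalcRule g i t (.definite (i y z) [i x y, .nom y, i x z])
  | r28 (x y z : Const NC NR NI) : CalcRule g i t (.definite (i x z) [i x y, .nom y, i y z])
  | r29 (x y z : Const NC NR NI) (u : NR) :
      CalcRule g i t (.definite (t z u y) [i x y, .nom y, t z u x])

/-- `Π_IR`: instance checking, subclass checking (`instSc A B A` stands for `A ⊑ B`), specificity,
and the rules that generate typical properties. -/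
inductive IRRule : Rule (Atom NC NR NI) → Prop
  | inst (ρ : Rule (Atom NC NR NI)) : CalcRule [] .inst .triple ρ → IRRule ρ
  | constraint (z u : Const NC NR NI) : IRRule ⟨.none, [.bot z, .inst u z], []⟩
  | scInit (q : Const NC NR NI) : IRRule (.definite (.instSc q q q) [.cls q])
  | sc (q : Const NC NR NI) (ρ : Rule (Atom NC NR NI)) :
      CalcRule [.cls q] (fun x y => .instSc x y q) (fun x r y => .tripleSc x r y q) ρ → IRRule ρ
  | morespec (c d : Const NC NR NI) :
      IRRule ⟨.atom (.morespec c d), [.dcls c, .dcls d, .instSc c d c], [.instSc d c d]⟩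
  | a (c d : Const NC NR NI) :
      IRRule ⟨.choice (.inst .auxC d), [.dcls c, .inst .auxC c, .tprop c d], []⟩
  | b (x y c : Const NC NR NI) : IRRule (.definite (.inst y c) [.auxtc y c, .inst x c])
  | c (y c : Const NC NR NI) : IRRule (.definite (.typ y c) [.auxtc y c, .inst y c])
  | d (y c d : Const NC NR NI) (n : ℕ) :
      IRRule (.definite (.inst y d) [.subTyp c d n, .typ y c])

/-- `Π_{C,D}`: normalized axioms defining the names of the subconcepts of `C` and `D`, a new name for
`C` itself, and the facts on `aux_C`. -/
inductive QueryFact (C D : Concept NC NR) : Atom NC NR NI → Prop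
  | cls (E : Concept NC NR) : E ∈ C.subs ∪ D.subs → QueryFact C D (.cls (nameOf E))
  | top : .top ∈ C.subs ∪ D.subs → QueryFact C D (.top (nameOf .top))
  | bot : .bot ∈ C.subs ∪ D.subs → QueryFact C D (.bot (nameOf .bot))
  | interLeft (E F : Concept NC NR) : .inter E F ∈ C.subs ∪ D.subs →
      QueryFact C D (.subClass (nameOf (.inter E F)) (nameOf E))
  | interRight (E F : Concept NC NR) : .inter E F ∈ C.subs ∪ D.subs →
      QueryFact C D (.subClass (nameOf (.inter E F)) (nameOf F))
  | inter (E F : Concept NC NR) : .inter E F ∈ C.subs ∪ D.subs →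
      QueryFact C D (.subConj (nameOf E) (nameOf F) (nameOf (.inter E F)))
  | exSub (r : NR) (F : Concept NC NR) : .ex r F ∈ C.subs ∪ D.subs →
      QueryFact C D (.subEx r (nameOf F) (nameOf (.ex r F)))
  | exSup (r : NR) (F : Concept NC NR) : .ex r F ∈ C.subs ∪ D.subs →
      QueryFact C D (.supEx (nameOf (.ex r F)) r (nameOf F) (.wit (.ex r F) r F))
  | qcls : QueryFact C D (.cls .qcls)
  | qSub : QueryFact C D (.subClass .qcls (nameOf C))
  | qSup : QueryFact C D (.subClass (nameOf C) .qcls)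
  | auxtc : QueryFact C D (.auxtc .auxC .qcls)
  | nom : QueryFact C D (.nom .auxC)
  | inst : QueryFact C D (.inst .auxC .qcls)

/-- The base program `Π(K,C,D)`. -/
def baseProgram (K : RankedKB NC NR NI) (C D : Concept NC NR) : Set (Rule (Atom NC NR NI)) :=
  {ρ | KBRule K ρ ∨ IRRule ρ ∨ ∃ a, QueryFact C D a ∧ ρ = .fact a}

/-! ## The preference program

The preference program is not recursive, so each of its predicates is defined by the disjunction of
the bodies of its rules. `holds(a)` is `a ∈ S`
and `holds'(a)` is `a ∈ S'`. -/

/-- `sat` (for `X = S`) and `sat1` (for `X = S'`). -/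
def Sat (S X : Set (Atom NC NR NI)) (c e : Const NC NR NI) : Prop :=
  (Atom.inst .auxC e ∈ X ∧ ∃ n, Atom.subTyp c e n ∈ S) ∨
    (Atom.inst .auxC c ∉ X ∧ ∃ n, Atom.subTyp c e n ∈ S)

/-- The value of the aggregate
`#sum { -1,E : sat(auxC,c,E), holds(subTyp(c,E,n)); 1,E : sat1(auxC,c,E), holds(subTyp(c,E,n)) }`. -/
noncomputable def aggregate (S S' : Set (Atom NC NR NI)) (c : Const NC NR NI) (n : ℕ) : ℤ :=
  -({e | Sat S S c e ∧ Atom.subTyp c e n ∈ S}.ncard : ℤ) +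
    ({e | Sat S S' c e ∧ Atom.subTyp c e n ∈ S}.ncard : ℤ)

def MoreProp (S S' : Set (Atom NC NR NI)) (c : Const NC NR NI) (n : ℕ) : Prop :=
  Atom.validrank c n ∈ S ∧ aggregate S S' c n ≤ -1

def SameNumProp (S S' : Set (Atom NC NR NI)) (c : Const NC NR NI) (n : ℕ) : Prop :=
  Atom.validrank c n ∈ S ∧ 0 ≤ aggregate S S' c n ∧ aggregate S S' c n ≤ 0

def BetterWrt (S S' : Set (Atom NC NR NI)) (c : Const NC NR NI) : Prop :=
  Atom.dcls c ∈ S ∧ ∃ n, MoreProp S S' c n ∧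
    ∀ m, Atom.validrank c m ∈ S → n < m → SameNumProp S S' c m

def BetterEqWrt (S S' : Set (Atom NC NR NI)) (c : Const NC NR NI) : Prop :=
  BetterWrt S S' c ∨
    (Atom.dcls c ∈ S ∧ ∀ m, Atom.validrank c m ∈ S → SameNumProp S S' c m)

def NoAttack (S S' : Set (Atom NC NR NI)) (c : Const NC NR NI) : Prop :=
  (Atom.dcls c ∈ S ∧ BetterEqWrt S S' c) ∨
    ∃ h, Atom.dcls c ∈ S ∧ Atom.dcls h ∈ S ∧ Atom.morespec h c ∈ S ∧ BetterWrt S S' h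

/-- `S` is better than `S'`. -/
def Better (S S' : Set (Atom NC NR NI)) : Prop :=
  ∃ c, Atom.dcls c ∈ S ∧ BetterWrt S S' c ∧ ∀ d, Atom.dcls d ∈ S → NoAttack S S' d

/-- `S` is a preferred answer set of the base program: no answer set is better than `S`. -/
def IsPreferredAnswerSet (K : RankedKB NC NR NI) (C D : Concept NC NR)
    (S : Set (Atom NC NR NI)) : Prop :=
  IsAnswerSet (baseProgram K C D) S ∧
    ∀ S', IsAnswerSet (baseProgram K C D) S' → ¬ Better S' S

end Program

end CwM

namespace CwM

/-! ## Comparison of counts by rank -/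

/-! Preference between elements of a model and preference between answer sets are the same
comparison: both depend only on which defeasible inclusions each side satisfies.
`CwmInterpretation.lt_iff_preferred` and `IsAnswerSet.better_iff` reduce both to
`RankedKB.Preferred`, and `RankedKB.Preferred.mono` says that the preferred side may satisfy more
and the other side less. It remains to pass between instances of `C` and answer sets.

From elements to answer sets: given an instance `x` of `C` in a `T`-compliant model of the strict
part and the ABox, let the choice rules select exactly properties of `x`. Negation occurs only in
the rule for `morespec`, whose heads occur in no body, so an answer set results. The rules preserve
truth when constants are read as sets of elements, so everything derived for `auxC` holds of `x`.
Since `x` may belong to distinguished concepts that are not derived, the answer set satisfies at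
least the inclusions satisfied by `x` (`exists_answerSet_satisfiedIn`).

From answer sets to elements: the constants having an instance atom form a model of the strict part
and the ABox. The constants `typAux A` make it `T`-compliant, and `auxC` is an instance of `C` with
exactly the derived properties (`Materializes.mem_ext_iff`, `IsAnswerSet.isTCompliant`).

For (1), a minimal instance of `C` outside `D` yields an answer set. If another one were better,
canonicity would realize the type of its `auxC`; as `C` is built from occurring concepts, this would
be an instance of `C` below the minimal one.

For (2), the materialization need be neither canonical nor finite. Disjoint unions add the missing
types and prototypes (`exists_canonical_extension`), and a construction on sets of elements yields a
finite model that keeps the role chains (`RankedKB.exists_finite_model`). An instance of `C` below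
the copy of `auxC` would yield an answer set better than the preferred one. -/

/-- `f` exceeds `g` at the highest argument where they differ. -/
def LexGT (f g : ℕ → ℕ) : Prop :=
  ∃ l, g l < f l ∧ ∀ h, l < h → f h = g h

/-- `f` vanishes from some argument on. -/
def Bounded (f : ℕ → ℕ) : Prop := ∃ N, ∀ n, N ≤ n → f n = 0

theorem LexGT.asymm {f g : ℕ → ℕ} (h : LexGT f g) : ¬ LexGT g f := by
  rintro ⟨m, hm, hm'⟩
  obtain ⟨l, hl, hl'⟩ := h
  rcases lt_trichotomy l m with h | h | h
  · have := hl' m h; omega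
  · subst h; omega
  · have := hm' l h; omega

theorem LexGT.irrefl (f : ℕ → ℕ) : ¬ LexGT f f := fun h => h.asymm h

theorem LexGT.trans {f g k : ℕ → ℕ} (h : LexGT f g) (h' : LexGT g k) : LexGT f k := by
  obtain ⟨l, hl, hl'⟩ := h
  obtain ⟨m, hm, hm'⟩ := h'
  rcases lt_trichotomy l m with h | h | h
  · exact ⟨m, by have := hl' m h; omega, fun n hn => (hl' n (h.trans hn)).trans (hm' n hn)⟩
  · subst h
    exact ⟨l, hm.trans hl, fun n hn => (hl' n hn).trans (hm' n hn)⟩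
  · exact ⟨l, by have := hm' l h; omega, fun n hn => (hl' n hn).trans (hm' n (h.trans hn))⟩

/-- Boundedness leaves only finitely many arguments where the functions differ, so a highest one
exists. -/
theorem LexGT.trichotomy {f g : ℕ → ℕ} (hf : Bounded f) (hg : Bounded g) :
    f = g ∨ LexGT f g ∨ LexGT g f := by
  classical
  by_cases hfg : f = g
  · exact .inl hfg
  obtain ⟨N, hN⟩ := hf
  obtain ⟨N', hN'⟩ := hg
  let s := (Finset.range (N + N')).filter fun n => f n ≠ g n
  have mem : ∀ n, f n ≠ g n → n ∈ s := fun n hn => by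
    refine Finset.mem_filter.2 ⟨Finset.mem_range.2 ?_, hn⟩
    by_contra h
    exact hn ((hN n (by omega)).trans (hN' n (by omega)).symm)
  have hs : s.Nonempty := by
    obtain ⟨n, hn⟩ := Function.ne_iff.1 hfg
    exact ⟨n, mem n hn⟩
  have hne : f (s.max' hs) ≠ g (s.max' hs) := (Finset.mem_filter.1 (s.max'_mem hs)).2
  have above : ∀ h, s.max' hs < h → f h = g h := fun h hh => by
    by_contra hc
    exact absurd (s.le_max' h (mem h hc)) (by omega)
  rcases Nat.lt_or_gt_of_ne hne with h | h
  · exact .inr (.inr ⟨_, h, fun n hn => (above n hn).symm⟩)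
  · exact .inr (.inl ⟨_, h, above⟩)

theorem LexGT.not_iff {f g : ℕ → ℕ} (hf : Bounded f) (hg : Bounded g) :
    ¬ LexGT g f ↔ f = g ∨ LexGT f g := by
  constructor
  · intro h
    rcases LexGT.trichotomy hf hg with h' | h' | h'
    exacts [.inl h', .inr h', absurd h' h]
  · rintro (rfl | h)
    exacts [LexGT.irrefl f, h.asymm]

theorem not_lexGT_of_le {f g : ℕ → ℕ} (h : ∀ n, g n ≤ f n) : ¬ LexGT g f := by
  rintro ⟨l, hl, -⟩
  exact absurd (h l) (by omega)

/-- A pointwise larger function is never lexicographically smaller, so by trichotomy each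
replacement leaves the function unchanged or improves the comparison. -/
theorem LexGT.mono {f f' g g' : ℕ → ℕ} (hf : Bounded f) (hf' : Bounded f') (hg : Bounded g)
    (hg' : Bounded g') (hff : ∀ n, f n ≤ f' n) (hgg : ∀ n, g' n ≤ g n) (h : LexGT f g) :
    LexGT f' g' := by
  have h₁ : LexGT f' g := by
    rcases (LexGT.not_iff hf' hf).1 (not_lexGT_of_le hff) with h' | h'
    exacts [h' ▸ h, h'.trans h]
  rcases (LexGT.not_iff hg hg').1 (not_lexGT_of_le hgg) with h' | h'
  exacts [h' ▸ h₁, h₁.trans h']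

theorem LexGT.modular {f g : ℕ → ℕ} (k : ℕ → ℕ) (hg : Bounded g)
    (hk : Bounded k) (h : LexGT f g) : LexGT f k ∨ LexGT k g := by
  rcases LexGT.trichotomy hk hg with h' | h' | h'
  exacts [.inl (h' ▸ h), .inr h', .inl (h.trans h')]

/-! ## Answer sets -/

section ASP

variable {α : Type}

theorem IsAnswerSet.definite_mem {P : Set (Rule α)} {S : Set α} (hS : IsAnswerSet P S) {a : α}
    {body : List α} (hρ : Rule.definite a body ∈ P) (hb : ∀ b ∈ body, b ∈ S) : a ∈ S :=
  hS.1.1 (a, body) ⟨_, hρ, by simp [Rule.definite], rfl, .inl rfl⟩ hb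

theorem IsAnswerSet.fact_mem {P : Set (Rule α)} {S : Set α} (hS : IsAnswerSet P S) {a : α}
    (hρ : Rule.fact a ∈ P) : a ∈ S :=
  hS.definite_mem (body := []) hρ (by simp)

/-- Every atom of an answer set is the head of a rule that is applicable in it. -/
theorem IsAnswerSet.supported {P : Set (Rule α)} {S : Set α} (hS : IsAnswerSet P S) {a : α}
    (ha : a ∈ S) : ∃ ρ ∈ P, (ρ.head = .atom a ∨ ρ.head = .choice a) ∧ (∀ b ∈ ρ.pos, b ∈ S) ∧
      ∀ b ∈ ρ.neg, b ∉ S := by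
  by_contra hc
  -- Without an applicable rule for `a`, the set `S \ {a}` would still be closed under the reduct,
  -- against minimality.
  have : S ⊆ S \ {a} := hS.1.2 (by
    rintro ⟨e, body⟩ hd hb
    refine ⟨hS.1.1 _ hd fun b h => (hb b h).1, ?_⟩
    rintro rfl
    obtain ⟨ρ, hρ, hn, rfl, hh⟩ := hd
    exact hc ⟨ρ, hρ, hh.imp id And.left, fun b h => (hb b h).1, hn⟩)
  exact (this ha).2 rfl

/-- The rules of `P` without their negative bodies, where a choice is read as a definite rule if its
head is in `W`, and is dropped otherwise. -/
def positivePart (P : Set (Rule α)) (W : Set α) : Set (α × List α) :=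
  {d | ∃ ρ ∈ P, d.2 = ρ.pos ∧ (ρ.head = .atom d.1 ∨ (ρ.head = .choice d.1 ∧ d.1 ∈ W))}

/-- Dropping negative bodies only adds rules to the reduct. This is how properties of all derived
atoms are proved. -/
theorem IsAnswerSet.subset_of_closedUnder {P : Set (Rule α)} {S X : Set α} (hS : IsAnswerSet P S)
    (hX : ClosedUnder (positivePart P S) X) : S ⊆ X :=
  hS.1.2 fun d hd => hX d (by
    obtain ⟨ρ, hρ, -, h⟩ := hd
    exact ⟨ρ, hρ, h⟩)

/-- The least set closed under the rules with an empty negative body and the choices in `W`. -/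
def leastModel (P : Set (Rule α)) (W : Set α) : Set α :=
  ⋂₀ {X | ClosedUnder (positivePart {ρ ∈ P | ρ.neg = []} W) X}

theorem leastModel_closedUnder (P : Set (Rule α)) (W : Set α) :
    ClosedUnder (positivePart {ρ ∈ P | ρ.neg = []} W) (leastModel P W) :=
  fun d hd hb X hX => hX d hd fun b h => hb b h X hX

/-- The least model extended by the heads of the applicable rules with non-empty negative body. -/
def stratifiedModel (P : Set (Rule α)) (W : Set α) : Set α :=
  leastModel P W ∪ {a | ∃ ρ ∈ P, ρ.head = .atom a ∧ ρ.neg ≠ [] ∧ (∀ b ∈ ρ.pos, b ∈ leastModel P W) ∧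
    ∀ b ∈ ρ.neg, b ∉ leastModel P W}

theorem stratifiedModel_subset {P : Set (Rule α)} {W X : Set α}
    (hX : ClosedUnder (positivePart P W) X) : stratifiedModel P W ⊆ X := by
  have h : leastModel P W ⊆ X := Set.sInter_subset_of_mem fun d hd => hX d (by
    obtain ⟨ρ, hρ, h⟩ := hd
    exact ⟨ρ, hρ.1, h⟩)
  rintro a (ha | ⟨ρ, hρ, hh, -, hp, -⟩)
  · exact h ha
  · exact hX (a, ρ.pos) ⟨ρ, hρ, rfl, .inl hh⟩ fun b hb => h (hp b hb)

/-- If the heads of rules with non-empty negative body (those in `U`) occur in no body, the stratified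
model is the least model of its reduct. -/
theorem isAnswerSet_stratifiedModel {P : Set (Rule α)} {W U : Set α}
    (hneg : ∀ ρ ∈ P, ρ.neg ≠ [] → ∃ a ∈ U, ρ.head = .atom a)
    (hpos : ∀ ρ ∈ P, ∀ a ∈ U, (ρ.head = .atom a → ρ.neg ≠ []) ∧ ρ.head ≠ .choice a ∧ a ∉ ρ.pos ∧
      a ∉ ρ.neg)
    (hcon : ∀ ρ ∈ P, ρ.head = .none → ¬ ∀ b ∈ ρ.pos, b ∈ stratifiedModel P W) :
    IsAnswerSet P (stratifiedModel P W) := by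
  have inU : ∀ a ∈ stratifiedModel P W, a ∉ leastModel P W → a ∈ U := by
    rintro a (ha | ⟨ρ, hρ, hh, hn, -⟩) hna
    · exact absurd ha hna
    · obtain ⟨a', ha', h'⟩ := hneg ρ hρ hn
      rw [hh] at h'
      cases h'
      exact ha'
  have low : ∀ a ∈ stratifiedModel P W, a ∉ U → a ∈ leastModel P W := fun a ha hU => by
    by_contra hc
    exact hU (inU a ha hc)
  refine ⟨⟨?_, ?_⟩, fun ρ hρ hh h => hcon ρ hρ hh h.1⟩
  · rintro ⟨a, body⟩ ⟨ρ, hρ, hn, rfl, hh⟩ hb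
    have hb' : ∀ b ∈ ρ.pos, b ∈ leastModel P W := fun b h =>
      low b (hb b h) fun hU => (hpos ρ hρ b hU).2.2.1 h
    rcases hh with hh | hh
    · by_cases hnil : ρ.neg = []
      · exact .inl (leastModel_closedUnder P W (a, ρ.pos) ⟨ρ, ⟨hρ, hnil⟩, rfl, .inl hh⟩ hb')
      · exact .inr ⟨ρ, hρ, hh, hnil, hb', fun b h h' => hn b h (.inl h')⟩
    · exact hh.2
  · intro X hX
    -- Intersecting with the least model keeps the head of each applied choice inside the candidate
    -- answer set, so the corresponding rule is in the reduct.
    have hsub : leastModel P W ⊆ X ∩ leastModel P W := Set.sInter_subset_of_mem (by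
      rintro ⟨a, body⟩ hd hb
      have ha : a ∈ leastModel P W := leastModel_closedUnder P W _ hd fun b h => (hb b h).2
      refine ⟨?_, ha⟩
      obtain ⟨ρ, hρ, rfl, hh⟩ := hd
      refine hX (a, ρ.pos) ⟨ρ, hρ.1, by simp [hρ.2], rfl, hh.imp id fun h => ⟨h.1, .inl ha⟩⟩
        fun b h => (hb b h).1)
    rintro a (ha | ⟨ρ, hρ, hh, hn, hp, hq⟩)
    · exact (hsub ha).1
    · refine hX (a, ρ.pos) ⟨ρ, hρ, fun b h hS => ?_, rfl, .inl hh⟩ fun b h => (hsub (hp b h)).1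
      exact hq b h (low b hS fun hU => (hpos ρ hρ b hU).2.2.2 h)

/-- Only the lower stratum is closed under the choices in `W`; body atoms outside `U` must already
lie there. -/
theorem choice_mem_stratifiedModel {P : Set (Rule α)} {W U : Set α}
    (hneg : ∀ ρ ∈ P, ρ.neg ≠ [] → ∃ a ∈ U, ρ.head = .atom a) {a : α} {body : List α}
    (hρ : ⟨.choice a, body, []⟩ ∈ P) (ha : a ∈ W)
    (hb : ∀ b ∈ body, b ∈ stratifiedModel P W ∧ b ∉ U) : a ∈ stratifiedModel P W := by
  refine .inl (leastModel_closedUnder P W (a, body) ⟨_, ⟨hρ, rfl⟩, rfl, .inr ⟨rfl, ha⟩⟩ ?_)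
  intro b h
  rcases (hb b h).1 with h' | ⟨ρ, hρ', hh, hn, -⟩
  · exact h'
  · obtain ⟨a', ha', h'⟩ := hneg ρ hρ' hn
    rw [hh] at h'
    cases h'
    exact absurd ha' (hb b h).2

end ASP

variable {NC NR NI Δ : Type}

/-! ## Preferences as comparisons of counts -/

theorem finite_typ (T : Finset (Concept NC NR × ℕ)) (l : ℕ) (P : Concept NC NR → Prop) :
    {D | (D, l) ∈ T ∧ P D}.Finite :=
  (T.finite_toSet.image Prod.fst).subset fun D hD => ⟨(D, l), hD.1, rfl⟩

theorem bounded_ncard (T : Finset (Concept NC NR × ℕ)) (P : Concept NC NR → Prop) :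
    Bounded fun l => {D | (D, l) ∈ T ∧ P D}.ncard := by
  refine ⟨T.sup Prod.snd + 1, fun n hn => ?_⟩
  have : {D | (D, n) ∈ T ∧ P D} = ∅ := by
    ext D
    simp only [Set.mem_ofPred_eq, Set.mem_empty_iff_false, iff_false, not_and]
    intro h
    have := Finset.le_sup (f := Prod.snd) h
    simp only at this
    omega
  simp [this]

/-- The number of defeasible inclusions `T(A) ⊑ B` of rank `l` with `sat A B`. -/
noncomputable def RankedKB.count (K : RankedKB NC NR NI) (sat : NC → NC → Prop) (A : NC) (l : ℕ) :
    ℕ :=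
  {B : NC | (Concept.atom B, l) ∈ K.typ (.atom A) ∧ sat A B}.ncard

theorem RankedKB.finite_count (K : RankedKB NC NR NI) (P : NC → Prop) (A : NC) (l : ℕ) :
    {B : NC | (Concept.atom B, l) ∈ K.typ (.atom A) ∧ P B}.Finite := by
  refine Set.Finite.of_finite_image (f := Concept.atom (NR := NR))
    ((finite_typ (K.typ (.atom A)) l fun _ => True).subset ?_) fun B _ B' _ h => by cases h; rfl
  rintro _ ⟨B, hB, rfl⟩
  exact ⟨hB.1, trivial⟩

theorem RankedKB.count_mono (K : RankedKB NC NR NI) {p q : NC → NC → Prop} {A : NC}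
    (h : ∀ B l, (Concept.atom B, l) ∈ K.typ (.atom A) → p A B → q A B) (l : ℕ) :
    K.count p A l ≤ K.count q A l :=
  Set.ncard_le_ncard (fun B hB => ⟨hB.1, h B l hB.1 hB.2⟩) (K.finite_count _ A l)

theorem RankedKB.bounded_count (K : RankedKB NC NR NI) (p : NC → NC → Prop) (A : NC) :
    Bounded (K.count p A) := by
  obtain ⟨N, hN⟩ := bounded_ncard (K.typ (.atom A)) fun _ => True
  refine ⟨N, fun n hn => ?_⟩
  have h := (Set.ncard_eq_zero (finite_typ _ _ _)).1 (hN n hn)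
  refine (Set.ncard_eq_zero (K.finite_count _ A n)).2 (Set.eq_empty_of_forall_notMem fun B hB => ?_)
  exact Set.eq_empty_iff_forall_notMem.1 h (.atom B) ⟨hB.1, trivial⟩

/-- Global preference of `p` over `q`, where `p` and `q` say which defeasible inclusions are
satisfied. -/
def RankedKB.Preferred (K : RankedKB NC NR NI) (p q : NC → NC → Prop) : Prop :=
  (∃ A, .atom A ∈ K.dist ∧ LexGT (K.count p A) (K.count q A)) ∧
    ∀ A, .atom A ∈ K.dist → ¬ LexGT (K.count q A) (K.count p A) ∨
      ∃ H, .atom H ∈ K.dist ∧ K.MoreSpecific (.atom H) (.atom A) ∧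
        LexGT (K.count p H) (K.count q H)

/-- Satisfying more inclusions on the preferred side preserves every strict advantage and creates no
new attack. This absorbs the slack between an element and the answer set it determines. -/
theorem RankedKB.Preferred.mono {K : RankedKB NC NR NI} {p p' q q' : NC → NC → Prop}
    (hp : ∀ A B l, .atom A ∈ K.dist → (Concept.atom B, l) ∈ K.typ (.atom A) → p A B → p' A B)
    (hq : ∀ A B l, .atom A ∈ K.dist → (Concept.atom B, l) ∈ K.typ (.atom A) → q' A B → q A B)
    (h : K.Preferred p q) : K.Preferred p' q' := by
  have up : ∀ A, .atom A ∈ K.dist → LexGT (K.count p A) (K.count q A) →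
      LexGT (K.count p' A) (K.count q' A) := fun A hA =>
    LexGT.mono (K.bounded_count _ _) (K.bounded_count _ _) (K.bounded_count _ _)
      (K.bounded_count _ _) (K.count_mono fun B l => hp A B l hA) (K.count_mono fun B l => hq A B l hA)
  have down : ∀ A, .atom A ∈ K.dist → LexGT (K.count q' A) (K.count p' A) →
      LexGT (K.count q A) (K.count p A) := fun A hA =>
    LexGT.mono (K.bounded_count _ _) (K.bounded_count _ _) (K.bounded_count _ _)
      (K.bounded_count _ _) (K.count_mono fun B l => hq A B l hA) (K.count_mono fun B l => hp A B l hA)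
  obtain ⟨⟨A, hA, h₁⟩, h₂⟩ := h
  refine ⟨⟨A, hA, up A hA h₁⟩, fun A hA => ?_⟩
  rcases h₂ A hA with h | ⟨H, hH, hm, h⟩
  · exact .inl fun h' => h (down A hA h')
  · exact .inr ⟨H, hH, hm, up H hH h⟩

/-- The defeasible inclusions satisfied by `x`. -/
def Interpretation.satisfied (I : Interpretation NC NR NI Δ) (x : Δ) (A B : NC) : Prop :=
  x ∉ I.con A ∨ x ∈ I.con B

theorem RankedKB.Normalized.numSat_eq {K : RankedKB NC NR NI} (hK : K.Normalized)
    (I : Interpretation NC NR NI Δ) {A : NC} (hA : .atom A ∈ K.dist) (x : Δ) :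
    (fun l => K.numSat I (.atom A) l x) = K.count (I.satisfied x) A := by
  funext l
  have : {D | (D, l) ∈ K.typ (.atom A) ∧ I.SatDefault (.atom A) D x} = Concept.atom ''
      {B : NC | (Concept.atom B, l) ∈ K.typ (.atom A) ∧ I.satisfied x A B} := by
    ext D
    constructor
    · rintro ⟨h₁, h₂⟩
      obtain ⟨B, hB⟩ := hK.typ _ hA _ h₁
      simp only at hB
      subst hB
      exact ⟨B, ⟨h₁, h₂⟩, rfl⟩
    · rintro ⟨B, hB, rfl⟩
      exact hB
  rw [RankedKB.numSat, this, Set.ncard_image_of_injective _ fun B B' h => by cases h; rfl]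
  rfl

theorem RankedKB.bounded_numSat (K : RankedKB NC NR NI) (I : Interpretation NC NR NI Δ)
    (C : Concept NC NR) (x : Δ) : Bounded fun l => K.numSat I C l x :=
  bounded_ncard _ _

/-- Counts by rank are bounded, so the preorder is total and its strict part is the plain
lexicographic comparison. -/
theorem RankedKB.prefLT_iff (K : RankedKB NC NR NI) (I : Interpretation NC NR NI Δ)
    (C : Concept NC NR) (x y : Δ) :
    K.prefLT I C x y ↔ LexGT (fun l => K.numSat I C l x) (fun l => K.numSat I C l y) := by
  have h : ∀ x y, K.prefLE I C x y ↔ (fun l => K.numSat I C l x) = (fun l => K.numSat I C l y) ∨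
      LexGT (fun l => K.numSat I C l x) (fun l => K.numSat I C l y) := fun x y => by
    rw [funext_iff]; rfl
  rw [RankedKB.prefLT, h, h, ← LexGT.not_iff (K.bounded_numSat ..) (K.bounded_numSat ..),
    ← LexGT.not_iff (K.bounded_numSat ..) (K.bounded_numSat ..), not_not]
  exact and_iff_right_of_imp LexGT.asymm

theorem CwmInterpretation.lt_iff_preferred {K : RankedKB NC NR NI} (hK : K.Normalized)
    (M : CwmInterpretation K Δ)
    (hM : ∀ C ∈ K.dist, ∀ x y, M.ltC C x y ↔ K.prefLT M.interp C x y) (x y : Δ) :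
    M.lt x y ↔ K.Preferred (M.interp.satisfied x) (M.interp.satisfied y) := by
  have key : ∀ A, .atom A ∈ K.dist → ∀ x y, M.ltC (.atom A) x y ↔
      LexGT (K.count (M.interp.satisfied x) A) (K.count (M.interp.satisfied y) A) :=
    fun A hA x y => by
      rw [hM _ hA, K.prefLT_iff, hK.numSat_eq _ hA, hK.numSat_eq _ hA]
  rw [M.lt_iff]
  constructor
  · rintro ⟨⟨C, hC, h₁⟩, h₂⟩
    obtain ⟨A, rfl⟩ := hK.dist C hC
    refine ⟨⟨A, hC, (key A hC x y).1 h₁⟩, fun A hA => ?_⟩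
    rcases h₂ _ hA with h | ⟨H, hH, hm, h⟩
    · exact .inl fun h' => h ((key A hA y x).2 h')
    · obtain ⟨B, rfl⟩ := hK.dist H hH
      exact .inr ⟨B, hH, hm, (key B hH x y).1 h⟩
  · rintro ⟨⟨A, hA, h₁⟩, h₂⟩
    refine ⟨⟨_, hA, (key A hA x y).2 h₁⟩, fun C hC => ?_⟩
    obtain ⟨A, rfl⟩ := hK.dist C hC
    rcases h₂ A hC with h | ⟨H, hH, hm, h⟩
    · exact .inl fun h' => h ((key A hC y x).1 h')
    · exact .inr ⟨_, hH, hm, (key H hH x y).2 h⟩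

/-- The multipreference interpretation determined by a finite interpretation. -/
def RankedKB.toCwm (K : RankedKB NC NR NI) [Finite Δ] (I : Interpretation NC NR NI Δ) :
    CwmInterpretation K Δ where
  interp := I
  ltC := K.prefLT I
  lt x y := (∃ C ∈ K.dist, K.prefLT I C x y) ∧
    ∀ C ∈ K.dist, ¬ K.prefLT I C y x ∨ ∃ H ∈ K.dist, K.MoreSpecific H C ∧ K.prefLT I H x y
  irrefl C _ x h := h.2 h.1
  trans C _ x y z h h' := by
    rw [K.prefLT_iff] at *
    exact h.trans h'
  wf C _ := by
    have : IsTrans Δ (K.prefLT I C) := ⟨fun x y z h h' => by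
      rw [K.prefLT_iff] at *
      exact h.trans h'⟩
    have : Std.Irrefl (K.prefLT I C) := ⟨fun x h => h.2 h.1⟩
    exact Finite.wellFounded_of_trans_of_irrefl _
  modular C _ x y z h := by
    rw [K.prefLT_iff] at *
    rw [K.prefLT_iff]
    exact h.modular _ (K.bounded_numSat ..) (K.bounded_numSat ..)
  lt_iff _ _ := Iff.rfl

/-! ## Subconcepts and occurring concepts -/

theorem Concept.mem_subs_self (E : Concept NC NR) : E ∈ E.subs := by
  cases E <;> simp [Concept.subs]

theorem Concept.subs_subset {E C : Concept NC NR} (h : E ∈ C.subs) : E.subs ⊆ C.subs := by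
  induction C with
  | atom A => cases h; rfl
  | top => cases h; rfl
  | bot => cases h; rfl
  | inter C D hC hD =>
    rcases h with h | h | h
    · cases h; rfl
    · exact (hC h).trans fun x hx => .inr (.inl hx)
    · exact (hD h).trans fun x hx => .inr (.inr hx)
  | ex r C hC =>
    rcases h with h | h
    · cases h; rfl
    · exact (hC h).trans fun x hx => .inr hx

theorem Concept.finite_subs (C : Concept NC NR) : C.subs.Finite := by
  induction C with
  | atom A => exact Set.finite_singleton _
  | top => exact Set.finite_singleton _
  | bot => exact Set.finite_singleton _
  | inter C D hC hD => exact (Set.finite_singleton _).union (hC.union hD)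
  | ex r C hC => exact (Set.finite_singleton _).union hC

theorem RankedKB.finite_occurring (K : RankedKB NC NR NI) : K.occurring.Finite := by
  have h₁ : (⋃ α ∈ (K.strict : Set (Inclusion NC NR)),
      {E | ∃ C D, Inclusion.concept C D = α ∧ (E ∈ C.subs ∨ E ∈ D.subs)}).Finite := by
    refine K.strict.finite_toSet.biUnion fun α _ => ?_
    cases α with
    | concept C D =>
      refine (C.finite_subs.union D.finite_subs).subset ?_
      rintro E ⟨_, _, h, h'⟩
      cases h
      exact h'
    | role r rs t => exact Set.finite_empty.subset (by rintro E ⟨_, _, h, -⟩; cases h)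
  have h₂ : (⋃ C ∈ (K.dist : Set (Concept NC NR)), (C.subs ∪
      ⋃ p ∈ (K.typ C : Set (Concept NC NR × ℕ)), p.1.subs)).Finite :=
    K.dist.finite_toSet.biUnion fun C _ => C.finite_subs.union
      ((K.typ C).finite_toSet.biUnion fun p _ => p.1.finite_subs)
  have h₃ : (⋃ α ∈ (K.abox : Set (Assertion NC NR NI)),
      {E | ∃ C a, Assertion.concept C a = α ∧ E ∈ C.subs}).Finite := by
    refine K.abox.finite_toSet.biUnion fun α _ => ?_
    cases α with
    | concept C a =>
      refine C.finite_subs.subset ?_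
      rintro E ⟨_, _, h, h'⟩
      cases h
      exact h'
    | role r a b => exact Set.finite_empty.subset (by rintro E ⟨_, _, h, -⟩; cases h)
  refine (h₁.union (h₂.union h₃)).subset ?_
  rintro E (⟨C, D, h, hE⟩ | ⟨C, hC, hE⟩ | ⟨C, a, h, hE⟩)
  · exact .inl (Set.mem_biUnion h ⟨C, D, rfl, hE⟩)
  · refine .inr (.inl (Set.mem_biUnion hC ?_))
    rcases hE with h | ⟨p, hp, h⟩
    · exact .inl h
    · exact .inr (Set.mem_biUnion hp h)
  · exact .inr (.inr (Set.mem_biUnion h ⟨C, a, rfl, hE⟩))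

theorem RankedKB.subs_subset_occurring (K : RankedKB NC NR NI) {E : Concept NC NR}
    (h : E ∈ K.occurring) : E.subs ⊆ K.occurring := by
  intro F hF
  rcases h with ⟨C, D, h, hE⟩ | ⟨C, hC, hE⟩ | ⟨C, a, h, hE⟩
  · exact .inl ⟨C, D, h, hE.imp (Concept.subs_subset · hF) (Concept.subs_subset · hF)⟩
  · exact .inr (.inl ⟨C, hC, hE.imp (Concept.subs_subset · hF)
      fun ⟨p, hp, h⟩ => ⟨p, hp, Concept.subs_subset h hF⟩⟩)
  · exact .inr (.inr ⟨C, a, h, Concept.subs_subset hE hF⟩)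

theorem RankedKB.dist_subset_occurring (K : RankedKB NC NR NI) {C : Concept NC NR}
    (h : C ∈ K.dist) : C ∈ K.occurring :=
  .inr (.inl ⟨C, h, .inl C.mem_subs_self⟩)

theorem RankedKB.typ_subset_occurring (K : RankedKB NC NR NI) {C : Concept NC NR}
    (h : C ∈ K.dist) {p : Concept NC NR × ℕ} (hp : p ∈ K.typ C) : p.1 ∈ K.occurring :=
  .inr (.inl ⟨C, h, .inr ⟨p, hp, p.1.mem_subs_self⟩⟩)

theorem RankedKB.isPrototype_of_iff {Δ' : Type} {K : RankedKB NC NR NI}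
    {I : Interpretation NC NR NI Δ} {I' : Interpretation NC NR NI Δ'} {x : Δ} {x' : Δ'}
    (h : ∀ E ∈ K.occurring, (x' ∈ I'.ext E ↔ x ∈ I.ext E)) {C : Concept NC NR} (hC : C ∈ K.dist)
    (hx : K.IsPrototype I C x) : K.IsPrototype I' C x' :=
  ⟨(h C (K.dist_subset_occurring hC)).2 hx.1, fun p hp => (hx.2 p hp).imp
    (fun h' h'' => h' ((h C (K.dist_subset_occurring hC)).1 h''))
    (h p.1 (K.typ_subset_occurring hC hp)).2⟩

/-- Canonicity controls only types over occurring concepts; Boolean combinations of these are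
determined by the type, whereas new existential restrictions would not be. -/
theorem Concept.BuiltFrom.ext_iff {Δ' : Type} {X : Set (Concept NC NR)}
    {I : Interpretation NC NR NI Δ} {I' : Interpretation NC NR NI Δ'} {x : Δ} {x' : Δ'}
    (h : ∀ E ∈ X, (x' ∈ I'.ext E ↔ x ∈ I.ext E)) {C : Concept NC NR} (hC : C.BuiltFrom X) :
    x' ∈ I'.ext C ↔ x ∈ I.ext C := by
  induction C with
  | atom A => exact h _ hC
  | top => exact Iff.rfl
  | bot => exact Iff.rfl
  | inter C D hC' hD' => exact and_congr (hC' hC.1) (hD' hC.2)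
  | ex r C _ => exact h _ hC

/-! ## Consistency of sets of literals -/

theorem Interpretation.mem_ext_foldr {NC' : Type} (I : Interpretation NC' NR NI Δ) (x : Δ)
    {β : Type} (f : β → Concept NC' NR) (L : List β) :
    x ∈ I.ext (L.foldr (fun p E => .inter (f p) E) .top) ↔ ∀ p ∈ L, x ∈ I.ext (f p) := by
  induction L with
  | nil => simp [Interpretation.ext]
  | cons p L ih =>
    simp only [List.foldr_cons, List.forall_mem_cons, ← ih]
    rfl

/-- Restriction of an interpretation along a renaming. -/
def Interpretation.comap {NC' : Type} (f : NC → NC') (I : Interpretation NC' NR NI Δ) :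
    Interpretation NC NR NI Δ :=
  ⟨fun A => I.con (f A), I.role, I.ind⟩

theorem Interpretation.ext_comap {NC' : Type} (f : NC → NC') (I : Interpretation NC' NR NI Δ)
    (E : Concept NC NR) : (I.comap f).ext E = I.ext (E.map f) := by
  induction E with
  | atom A => rfl
  | top => rfl
  | bot => rfl
  | inter E F hE hF => simp only [Interpretation.ext, Concept.map, hE, hF]
  | ex r E hE => simp only [Interpretation.ext, Concept.map, hE]; rfl

theorem Interpretation.chain_comap {NC' : Type} (f : NC → NC') (I : Interpretation NC' NR NI Δ)
    (r : NR) (rs : List NR) (x y : Δ) : (I.comap f).chain r rs x y ↔ I.chain r rs x y := by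
  induction rs generalizing r x with
  | nil => exact Iff.rfl
  | cons s rs ih => exact exists_congr fun z => and_congr Iff.rfl (ih s z)

theorem Interpretation.satInclusion_comap {NC' : Type} (f : NC → NC')
    (I : Interpretation NC' NR NI Δ) (α : Inclusion NC NR) :
    (I.comap f).SatInclusion α ↔ I.SatInclusion (α.map f) := by
  cases α with
  | concept C D => simp only [Interpretation.SatInclusion, Inclusion.map, Interpretation.ext_comap]
  | role r rs t =>
    simp only [Interpretation.SatInclusion, Inclusion.map, Interpretation.chain_comap]
    rfl

/-- Interpreting each new name as the actual complement satisfies the added disjointness axioms. -/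
theorem RankedKB.consistentWith_of_mem (K : RankedKB NC NR NI) {I : Interpretation NC NR NI Δ}
    (hI : I.SatTBox K.strict) (x : Δ) {L : List (Concept NC NR × Bool)}
    (hL : ∀ p ∈ L, (p.2 = true ↔ x ∈ I.ext p.1)) : K.ConsistentWith L := by
  intro hE
  let I' : Interpretation (NC ⊕ Concept NC NR) NR NI Δ :=
    ⟨Sum.elim I.con fun E => (I.ext E)ᶜ, I.role, I.ind⟩
  have hext : ∀ E, I'.ext (E.map Sum.inl) = I.ext E := fun E =>
    (Interpretation.ext_comap Sum.inl I' E).symm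
  have hT : I'.SatTBox K.constrTBox := by
    rintro _ (⟨α, hα, rfl⟩ | ⟨E, -, rfl⟩)
    · exact (Interpretation.satInclusion_comap Sum.inl I' α).1 (hI α hα)
    · rintro y ⟨h₁, h₂⟩
      exact h₂ ((hext E).subset h₁)
  have : Nonempty Δ := ⟨x⟩
  refine hE Δ I' hT ((I'.mem_ext_foldr x litConcept L).2 fun p hp => ?_)
  obtain ⟨E, b⟩ := p
  have hp := hL _ hp
  cases b
  · exact fun h => Bool.false_ne_true (hp.2 h)
  · exact (hext E).superset (hp.1 rfl)

theorem RankedKB.ConsistentWith.exists_model {K : RankedKB NC NR NI}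
    {L : List (Concept NC NR × Bool)} (h : K.ConsistentWith L) (hL : ∀ p ∈ L, p.1 ∈ K.occurring) :
    ∃ (Δ : Type) (I : Interpretation NC NR NI Δ), I.SatTBox K.strict ∧
      ∃ x, ∀ p ∈ L, (p.2 = true → x ∈ I.ext p.1) ∧ (p.2 = false → x ∉ I.ext p.1) := by
  simp only [RankedKB.ConsistentWith, Entails, not_forall] at h
  obtain ⟨Δ, -, I, hI, hsub⟩ := h
  obtain ⟨x, hx, -⟩ := Set.not_subset.1 hsub
  rw [Interpretation.mem_ext_foldr] at hx
  refine ⟨Δ, I.comap Sum.inl, fun α hα => (I.satInclusion_comap _ α).2 (hI _ (.inl ⟨α, hα, rfl⟩)), x,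
    fun p hp => ?_⟩
  have h₁ := hx p hp
  have h₂ := hI _ (.inr ⟨p.1, hL p hp, rfl⟩)
  obtain ⟨E, b⟩ := p
  rw [Interpretation.ext_comap]
  cases b
  · exact ⟨fun h => absurd h (by simp), fun _ h => h₂ ⟨h, h₁⟩⟩
  · exact ⟨fun _ => h₁, fun h => absurd h (by simp)⟩

/-- Finitely many concepts occur, so the full type of `y` is one finite list of literals, and `y`
itself witnesses its consistency. -/
theorem RankedKB.IsCanonical.exists_same_type {Δ' : Type} {K : RankedKB NC NR NI}
    {I : Interpretation NC NR NI Δ} (hI : K.IsCanonical I) {J : Interpretation NC NR NI Δ'}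
    (hJ : J.SatTBox K.strict) (y : Δ') :
    ∃ x, ∀ E ∈ K.occurring, (x ∈ I.ext E ↔ y ∈ J.ext E) := by
  classical
  let L : List (Concept NC NR × Bool) :=
    K.finite_occurring.toFinset.toList.map fun E => (E, decide (y ∈ J.ext E))
  obtain ⟨x, hx⟩ := hI.2 L (by simp [L]) (K.consistentWith_of_mem hJ y (by simp [L]))
  refine ⟨x, fun E hE => ?_⟩
  have := hx (E, decide (y ∈ J.ext E)) (by simpa [L] using hE)
  simp only [decide_eq_true_eq, decide_eq_false_iff_not] at this
  exact ⟨not_imp_not.1 this.2, this.1⟩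

/-! ## Disjoint unions -/

/-- The disjoint union of a family of interpretations, with the individuals of the `i₀`-th one. -/
def Interpretation.sigma {ι : Type} {Δ : ι → Type} (I : ∀ i, Interpretation NC NR NI (Δ i)) (i₀ : ι) :
    Interpretation NC NR NI (Σ i, Δ i) where
  con A := {x | x.2 ∈ (I x.1).con A}
  role r x y := ∃ i a b, x = ⟨i, a⟩ ∧ y = ⟨i, b⟩ ∧ (I i).role r a b
  ind a := ⟨i₀, (I i₀).ind a⟩

section Sigma

variable {ι : Type} {Δ : ι → Type} (I : ∀ i, Interpretation NC NR NI (Δ i)) (i₀ : ι)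

theorem Interpretation.mem_ext_sigma (E : Concept NC NR) (i : ι) (a : Δ i) :
    (⟨i, a⟩ : Σ i, Δ i) ∈ (Interpretation.sigma I i₀).ext E ↔ a ∈ (I i).ext E := by
  induction E generalizing a with
  | atom A => exact Iff.rfl
  | top => exact Iff.rfl
  | bot => exact Iff.rfl
  | inter E F hE hF => exact and_congr (hE a) (hF a)
  | ex r E hE =>
    constructor
    · rintro ⟨_, ⟨j, a', b, h, rfl, hr⟩, hb⟩
      cases h
      exact ⟨b, hr, (hE b).1 hb⟩
    · rintro ⟨b, hr, hb⟩
      exact ⟨⟨i, b⟩, ⟨i, a, b, rfl, rfl, hr⟩, (hE b).2 hb⟩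

theorem Interpretation.chain_sigma {r : NR} {rs : List NR} {x y : Σ i, Δ i}
    (h : (Interpretation.sigma I i₀).chain r rs x y) :
    ∃ i a b, x = ⟨i, a⟩ ∧ y = ⟨i, b⟩ ∧ (I i).chain r rs a b := by
  induction rs generalizing r x with
  | nil => exact h
  | cons s rs ih =>
    obtain ⟨z, ⟨i, a, b, rfl, rfl, hr⟩, hz⟩ := h
    obtain ⟨j, a', b', h, rfl, hc⟩ := ih hz
    cases h
    exact ⟨i, a, b', rfl, rfl, b, hr, hc⟩

theorem Interpretation.satTBox_sigma {T : Set (Inclusion NC NR)} (h : ∀ i, (I i).SatTBox T) :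
    (Interpretation.sigma I i₀).SatTBox T := by
  intro α hα
  cases α with
  | concept C D =>
    rintro ⟨i, a⟩ ha
    rw [Interpretation.mem_ext_sigma] at ha ⊢
    exact h i _ hα ha
  | role r rs t =>
    intro x y hxy
    obtain ⟨i, a, b, rfl, rfl, hc⟩ := Interpretation.chain_sigma I i₀ hxy
    exact ⟨i, a, b, rfl, rfl, h i _ hα a b hc⟩

theorem Interpretation.satAssertion_sigma {α : Assertion NC NR NI} (h : (I i₀).SatAssertion α) :
    (Interpretation.sigma I i₀).SatAssertion α := by
  cases α with
  | concept C a => exact (Interpretation.mem_ext_sigma I i₀ C i₀ _).2 h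
  | role r a b => exact ⟨i₀, _, _, rfl, rfl, h⟩

end Sigma

/-! ## Interpretations on sets of elements -/

/-- The interpretation on a family of sets of elements: `X` is related to `Y` if each element of `X`
is related to one of `Y`. -/
def Interpretation.onSets (J : Interpretation NC NR NI Δ) (𝓕 : Set (Set Δ)) (e : NI → 𝓕) :
    Interpretation NC NR NI 𝓕 where
  con A := {X | (X : Set Δ) ⊆ J.con A}
  role r X Y := ∀ a ∈ (X : Set Δ), ∃ b ∈ (Y : Set Δ), J.role r a b
  ind := e

section OnSets

variable {J : Interpretation NC NR NI Δ} {𝓕 : Set (Set Δ)} {e : NI → 𝓕}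

/-- Non-emptiness of the sets handles `⊥`; the hypothesis on `𝓕` provides successors for the
existential restrictions. -/
theorem Interpretation.mem_ext_onSets (h𝓕 : ∀ X ∈ 𝓕, X.Nonempty) {E : Concept NC NR}
    (hE : ∀ r F, .ex r F ∈ E.subs → (J.ext F).Nonempty → J.ext F ∈ 𝓕) (X : 𝓕) :
    X ∈ (J.onSets 𝓕 e).ext E ↔ (X : Set Δ) ⊆ J.ext E := by
  induction E generalizing X with
  | atom A => exact Iff.rfl
  | top => exact iff_of_true trivial (Set.subset_univ _)
  | bot => exact iff_of_false id fun h => (h𝓕 X X.2).ne_empty (Set.subset_empty_iff.1 h)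
  | inter E F iE iF =>
    refine Iff.trans (and_congr (iE (fun r G h => hE r G (.inr (.inl h))) X)
      (iF (fun r G h => hE r G (.inr (.inr h))) X)) Set.subset_inter_iff.symm
  | ex r E iE =>
    have iE := iE (fun r G h => hE r G (.inr h))
    constructor
    · rintro ⟨Y, hr, hY⟩ a ha
      obtain ⟨b, hb, hab⟩ := hr a ha
      exact ⟨b, hab, (iE Y).1 hY hb⟩
    · intro h
      obtain ⟨a, ha⟩ := h𝓕 X X.2
      obtain ⟨b, -, hb⟩ := h ha
      -- The whole extension of the filler serves as a single successor, since each element of `X`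
      -- has its own successor inside it.
      refine ⟨⟨J.ext E, hE r E (.inl rfl) ⟨b, hb⟩⟩, fun a ha => ?_, (iE _).2 subset_rfl⟩
      obtain ⟨b, hab, hb⟩ := h ha
      exact ⟨b, hb, hab⟩

/-- The ∀∃ reading of roles composes. Role inclusions use chains only on the left, so this direction
suffices. -/
theorem Interpretation.chain_onSets {r : NR} {rs : List NR} {X Y : 𝓕}
    (h : (J.onSets 𝓕 e).chain r rs X Y) : ∀ a ∈ (X : Set Δ), ∃ b ∈ (Y : Set Δ), J.chain r rs a b := by
  induction rs generalizing r X with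
  | nil => exact h
  | cons s rs ih =>
    obtain ⟨Z, hr, hZ⟩ := h
    intro a ha
    obtain ⟨c, hc, hac⟩ := hr a ha
    obtain ⟨b, hb, hcb⟩ := ih hZ c hc
    exact ⟨b, hb, c, hac, hcb⟩

theorem Interpretation.satTBox_onSets (h𝓕 : ∀ X ∈ 𝓕, X.Nonempty) {T : Set (Inclusion NC NR)}
    (hE : ∀ C D, .concept C D ∈ T → ∀ r F, .ex r F ∈ C.subs ∪ D.subs → (J.ext F).Nonempty →
      J.ext F ∈ 𝓕)
    (hJ : J.SatTBox T) : (J.onSets 𝓕 e).SatTBox T := by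
  intro α hα
  cases α with
  | concept C D =>
    intro X hX
    rw [Interpretation.mem_ext_onSets h𝓕 fun r F h => hE C D hα r F (.inl h)] at hX
    rw [Interpretation.mem_ext_onSets h𝓕 fun r F h => hE C D hα r F (.inr h)]
    exact hX.trans (hJ _ hα)
  | role r rs t =>
    intro X Y hXY a ha
    obtain ⟨b, hb, hab⟩ := Interpretation.chain_onSets hXY a ha
    exact ⟨b, hb, hJ _ hα a b hab⟩

end OnSets

/-- The individuals of an assertion. -/
def Assertion.inds : Assertion NC NR NI → Set NI
  | .concept _ a => {a}
  | .role _ a b => {a, b}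

theorem Assertion.finite_inds (α : Assertion NC NR NI) : α.inds.Finite := by
  cases α <;> simp [Assertion.inds]

/-- A model has a finite counterpart that realizes the same types over a finite set `Γ` of concepts
and, apart from these, only intersections of such types. -/
theorem RankedKB.exists_finite_model (K : RankedKB NC NR NI) [Nonempty Δ]
    {J : Interpretation NC NR NI Δ} (hJ : J.SatTBox K.strict)
    (hA : ∀ α ∈ K.abox, J.SatAssertion α) {Γ : Set (Concept NC NR)} (hfin : Γ.Finite)
    (hsubs : ∀ E ∈ Γ, E.subs ⊆ Γ) (hocc : K.occurring ⊆ Γ) :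
    ∃ (Δ' : Type) (_ : Finite Δ') (_ : Nonempty Δ') (F : Interpretation NC NR NI Δ'),
      F.SatTBox K.strict ∧ (∀ α ∈ K.abox, F.SatAssertion α) ∧
      (∀ d, ∃ d', ∀ E ∈ Γ, (d' ∈ F.ext E ↔ d ∈ J.ext E)) ∧
      ∀ d', ∃ X : Set Δ, X.Nonempty ∧ ∀ E ∈ Γ, (d' ∈ F.ext E ↔ X ⊆ J.ext E) := by
  classical
  let τ : Δ → Set (Concept NC NR) := fun d => {E ∈ Γ | d ∈ J.ext E}
  have hτ : (Set.range τ).Finite := hfin.finite_subsets.subset (by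
    rintro _ ⟨d, rfl⟩ E hE
    exact hE.1)
  let ρ : Set (Concept NC NR) → Δ := fun t => Classical.epsilon fun d => τ d = t
  -- `ρ` picks one representative for each of the finitely many realized types over `Γ`.
  have hρ : ∀ d, τ (ρ (τ d)) = τ d := fun d => Classical.epsilon_spec (p := fun d' => τ d' = τ d) ⟨d, rfl⟩
  let N : Set NI := ⋃ α ∈ (K.abox : Set (Assertion NC NR NI)), α.inds
  have hN : N.Finite := K.abox.finite_toSet.biUnion fun α _ => α.finite_inds
  -- Singletons of representatives realize the types, singletons of ABox individuals keep the role
  -- assertions, and extensions of concepts in `Γ` serve as existential witnesses.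
  let 𝓕 : Set (Set Δ) := (fun d => {d}) '' (ρ '' Set.range τ ∪ J.ind '' N) ∪
    {X | X.Nonempty ∧ X ∈ J.ext '' Γ}
  have h𝓕 : 𝓕.Finite := (((hτ.image _).union (hN.image _)).image _).union
    ((hfin.image _).subset fun X hX => hX.2)
  have hne : ∀ X ∈ 𝓕, X.Nonempty := by
    rintro X (⟨d, -, rfl⟩ | hX)
    · exact Set.singleton_nonempty d
    · exact hX.1
  have hrep : ∀ d, {ρ (τ d)} ∈ 𝓕 := fun d => .inl ⟨_, .inl ⟨_, ⟨d, rfl⟩, rfl⟩, rfl⟩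
  have hind : ∀ a ∈ N, {J.ind a} ∈ 𝓕 := fun a ha => .inl ⟨_, .inr ⟨a, ha, rfl⟩, rfl⟩
  have hex : ∀ E ∈ Γ, ∀ r F, .ex r F ∈ E.subs → (J.ext F).Nonempty → J.ext F ∈ 𝓕 :=
    fun E hE r F h hF => .inr ⟨hF, F, hsubs _ (hsubs E hE h) (.inr F.mem_subs_self), rfl⟩
  obtain ⟨d₀⟩ := ‹Nonempty Δ›
  -- Individuals outside the ABox are unconstrained; when their singleton is missing they are sent
  -- to an arbitrary representative.
  let e : NI → 𝓕 := fun a => if h : {J.ind a} ∈ 𝓕 then ⟨_, h⟩ else ⟨_, hrep d₀⟩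
  have he : ∀ a ∈ N, (e a : Set Δ) = {J.ind a} := fun a ha => by simp [e, hind a ha]
  have hext : ∀ E ∈ Γ, ∀ X : 𝓕, X ∈ (J.onSets 𝓕 e).ext E ↔ (X : Set Δ) ⊆ J.ext E :=
    fun E hE X => Interpretation.mem_ext_onSets hne (hex E hE) X
  refine ⟨𝓕, h𝓕.to_subtype, ⟨⟨_, hrep d₀⟩⟩, J.onSets 𝓕 e, ?_, ?_, fun d => ⟨⟨_, hrep d⟩, ?_⟩,
    fun X => ⟨X, hne X X.2, fun E hE => hext E hE X⟩⟩
  · refine Interpretation.satTBox_onSets hne (fun C D h r F hF => ?_) hJ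
    rcases hF with hF | hF
    · exact hex C (hocc (.inl ⟨C, D, h, .inl C.mem_subs_self⟩)) r F hF
    · exact hex D (hocc (.inl ⟨C, D, h, .inr D.mem_subs_self⟩)) r F hF
  · intro α hα
    have hm : ∀ a ∈ α.inds, (e a : Set Δ) = {J.ind a} := fun a ha =>
      he a (Set.mem_biUnion hα ha)
    have h := hA α hα
    cases α with
    | concept C a =>
      refine (hext C (hocc (.inr (.inr ⟨C, a, hα, C.mem_subs_self⟩))) (e a)).2 ?_
      rw [hm a rfl, Set.singleton_subset_iff]
      exact h
    | role r a b =>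
      intro x hx
      change x ∈ (e a : Set Δ) at hx
      rw [hm a (.inl rfl)] at hx
      cases hx
      exact ⟨J.ind b, by change _ ∈ (e b : Set Δ); rw [hm b (.inr rfl)]; rfl, h⟩
  · intro E hE
    rw [hext E hE, Set.singleton_subset_iff]
    have := Set.ext_iff.1 (hρ d) E
    simpa [τ, hE] using this

/-! ## Soundness of the base program -/

section Soundness

variable (K : RankedKB NC NR NI) (C D : Concept NC NR) (I : Interpretation NC NR NI Δ) (x : Δ)
  (p : NC → Δ)

/-- The set denoted by a constant in the position of a class: `x` stands for `auxC`. -/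
def clsDen : Const NC NR NI → Set Δ
  | .ind a => {I.ind a}
  | .cls A => I.con A
  | .defn E => I.ext E
  | .qcls => I.ext C
  | .wit _ _ _ => ∅
  | .typAux _ => ∅
  | .auxC => {x}

/-- The set denoted by a constant in the position of an instance: `p A` stands for `typAux A`. -/
def indDen : Const NC NR NI → Set Δ
  | .wit _ _ F => I.ext F
  | .typAux A => {p A}
  | c => clsDen C I x c

theorem clsDen_nameOf (E : Concept NC NR) : clsDen C I x (nameOf E) = I.ext E := by
  cases E <;> rfl

theorem indDen_nameOf (E : Concept NC NR) : indDen C I x p (nameOf E) = I.ext E := by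
  cases E <;> rfl

/-- A witness constant stands for a whole extension, so atoms compare sets. The guard `N` is the
condition for the derivation to have content: for subclass checking it is that the tested class is
non-empty. -/
def InstTrue (N : Prop) (c d : Const NC NR NI) : Prop :=
  N → (indDen C I x p c).Nonempty ∧ indDen C I x p c ⊆ clsDen C I x d

def TripleTrue (N : Prop) (c : Const NC NR NI) (r : NR) (d : Const NC NR NI) : Prop :=
  N → (indDen C I x p c).Nonempty ∧ ∀ a ∈ indDen C I x p c, ∃ b ∈ indDen C I x p d, I.role r a b

/-- Truth of ground atoms, where atoms on instances are taken to hold trivially unless `N`. -/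
def IsTrue (N : Prop) : Atom NC NR NI → Prop
  | .nom c => ∃ a, indDen C I x p c = {a} ∧ clsDen C I x c = {a}
  | .cls c => indDen C I x p c = clsDen C I x c
  | .rol _ => True
  | .top c => clsDen C I x c = Set.univ
  | .bot c => clsDen C I x c = ∅
  | .subClass c d => clsDen C I x c ⊆ clsDen C I x d
  | .subConj c d e => clsDen C I x c ∩ clsDen C I x d ⊆ clsDen C I x e
  | .subEx r c d => ∀ a b, I.role r a b → b ∈ clsDen C I x c → a ∈ clsDen C I x d
  | .supEx c r d e => indDen C I x p e ⊆ clsDen C I x d ∧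
      ∀ a ∈ clsDen C I x c, ∃ b ∈ indDen C I x p e, I.role r a b
  | .subRole r t => ∀ a b, I.role r a b → I.role t a b
  | .subRChain r s t => ∀ a b c, I.role r a b → I.role s b c → I.role t a c
  | .subTyp c d n => KBFact K (.subTyp c d n)
  | .dcls _ => True
  | .tprop _ _ => True
  | .validrank _ _ => True
  | .auxtc y c => N → (clsDen C I x c).Nonempty → (indDen C I x p y).Nonempty ∧
      indDen C I x p y ⊆ clsDen C I x c ∧
      ∀ d n, KBFact K (.subTyp c d n) → indDen C I x p y ⊆ clsDen C I x d
  | .inst c d => InstTrue C I x p N c d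
  | .triple c r d => TripleTrue C I x p N c r d
  | .instSc c d q => InstTrue C I x p (clsDen C I x q).Nonempty c d
  | .tripleSc c r d q => TripleTrue C I x p (clsDen C I x q).Nonempty c r d
  | .typ y c => N → (indDen C I x p y).Nonempty ∧
      ∀ d n, KBFact K (.subTyp c d n) → indDen C I x p y ⊆ clsDen C I x d
  | .morespec _ _ => True

variable {K C D I x p}

/-- The rules of the materialization calculus preserve truth. -/
theorem CalcRule.isTrue {M N : Prop} {g : List (Atom NC NR NI)}
    {i : Const NC NR NI → Const NC NR NI → Atom NC NR NI}
    {t : Const NC NR NI → NR → Const NC NR NI → Atom NC NR NI}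
    (hi : ∀ c d, IsTrue K C I x p M (i c d) = InstTrue C I x p N c d)
    (ht : ∀ c r d, IsTrue K C I x p M (t c r d) = TripleTrue C I x p N c r d)
    {ρ : Rule (Atom NC NR NI)} (hρ : CalcRule g i t ρ) (hb : ∀ b ∈ ρ.pos, IsTrue K C I x p M b)
    {a : Atom NC NR NI} (ha : ρ.head = .atom a ∨ ρ.head = .choice a) : IsTrue K C I x p M a := by
  cases hρ <;> simp only [Rule.definite, Head.atom.injEq, reduceCtorEq, or_false] at ha <;>
    subst ha <;> simp only [Rule.definite, List.forall_mem_cons, hi, ht] at hb ⊢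
  case r1 c =>
    obtain ⟨⟨a, h₁, h₂⟩, -⟩ := hb
    exact fun _ => by rw [h₁, h₂]; exact ⟨Set.singleton_nonempty a, subset_rfl⟩
  case r3 c z z' =>
    obtain ⟨h₁, h₂, -⟩ := hb
    exact fun n => ⟨(h₂ n).1, (Set.subset_univ _).trans (Eq.superset h₁)⟩
  case r4 c y z u z' =>
    obtain ⟨h₁, h₂, -⟩ := hb
    intro n
    obtain ⟨⟨a, ha⟩, h⟩ := h₂ n
    exact absurd (h ha) (by rw [show clsDen C I x z = ∅ from h₁]; exact id)
  case r5 c y z =>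
    obtain ⟨h₁, h₂, -⟩ := hb
    exact fun n => ⟨(h₂ n).1, (h₂ n).2.trans h₁⟩
  case r6 c y₁ y₂ z =>
    obtain ⟨h₁, h₂, h₃, -⟩ := hb
    exact fun n => ⟨(h₂ n).1, (Set.subset_inter (h₂ n).2 (h₃ n).2).trans h₁⟩
  case r7 c c' y z v =>
    obtain ⟨h₁, h₂, h₃, -⟩ := hb
    refine fun n => ⟨(h₂ n).1, fun a ha => ?_⟩
    obtain ⟨b, hb, hab⟩ := (h₂ n).2 a ha
    exact h₁ a b hab ((h₃ n).2 hb)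
  case r9 c c' y z v =>
    obtain ⟨h₁, h₂, -⟩ := hb
    exact fun n => ⟨(h₂ n).1, fun a ha => h₁.2 a ((h₂ n).2 ha)⟩
  case r10 c c' y z v =>
    obtain ⟨h₁, h₂, -⟩ := hb
    intro n
    obtain ⟨⟨a, ha⟩, h⟩ := h₂ n
    obtain ⟨b, hb, -⟩ := h₁.2 a (h ha)
    exact ⟨⟨b, hb⟩, h₁.1⟩
  case r13 c c' v w =>
    obtain ⟨h₁, h₂, -⟩ := hb
    refine fun n => ⟨(h₂ n).1, fun a ha => ?_⟩
    obtain ⟨b, hb, hab⟩ := (h₂ n).2 a ha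
    exact ⟨b, hb, h₁ a b hab⟩
  case r15 c c' c'' u v w =>
    obtain ⟨h₁, h₂, h₃, -⟩ := hb
    refine fun n => ⟨(h₂ n).1, fun a ha => ?_⟩
    obtain ⟨b, hb, hab⟩ := (h₂ n).2 a ha
    obtain ⟨d, hd, hbd⟩ := (h₃ n).2 b hb
    exact ⟨d, hd, h₁ a b d hab hbd⟩
  case r27 c y z =>
    obtain ⟨h₁, ⟨a, ha, ha'⟩, h₃, -⟩ := hb
    intro n
    obtain ⟨⟨b, hb⟩, h⟩ := h₁ n
    -- The set of `c` is non-empty and contained in the singleton of the nominal, hence contains its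
    -- element.
    have hba : b = a := by simpa [ha'] using h hb
    rw [ha]
    exact ⟨Set.singleton_nonempty a, Set.singleton_subset_iff.2 (hba ▸ (h₃ n).2 hb)⟩
  case r28 c y z =>
    obtain ⟨h₁, ⟨a, ha, ha'⟩, h₃, -⟩ := hb
    exact fun n => ⟨(h₁ n).1, (h₁ n).2.trans (by rw [ha', ← ha]; exact (h₃ n).2)⟩
  case r29 c y z u =>
    obtain ⟨h₁, ⟨a, ha, ha'⟩, h₃, -⟩ := hb
    refine fun n => ⟨(h₃ n).1, fun d hd => ?_⟩
    obtain ⟨b, hb, hdb⟩ := (h₃ n).2 d hd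
    exact ⟨b, by rw [ha, ← ha']; exact (h₁ n).2 hb, hdb⟩

theorem KBFact.isTrue {M : Prop} (hI : I.SatTBox K.strict) (hA : ∀ α ∈ K.abox, I.SatAssertion α)
    (hp : M → ∀ A, .atom A ∈ K.dist → (I.con A).Nonempty → K.IsPrototype I (.atom A) (p A))
    {a : Atom NC NR NI} (h : KBFact K a) : IsTrue K C I x p M a := by
  cases h with
  | nom a => exact ⟨_, rfl, rfl⟩
  | cls A => rfl
  | rol r => trivial
  | assertC A a h => exact Set.singleton_subset_iff.2 (hA _ h)
  | assertR r a b h =>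
    refine ⟨subset_rfl, ?_⟩
    rintro _ rfl
    exact ⟨_, rfl, hA _ h⟩
  | top A h => exact Set.univ_subset_iff.1 (hI _ h)
  | bot A h => exact Set.subset_empty_iff.1 (hI _ h)
  | sub A B h => exact hI _ h
  | conj A B B' h => exact hI _ h
  | exLeft r A B h => exact fun a b hab hb => hI _ h ⟨b, hab, hb⟩
  | exRight A r B h =>
    refine ⟨subset_rfl, fun a ha => ?_⟩
    obtain ⟨b, hab, hb⟩ := hI _ h ha
    exact ⟨b, hb, hab⟩
  | role r t h => exact hI _ h
  | chain r s t h => exact fun a b c hab hbc => hI _ h a c ⟨b, hab, hbc⟩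
  | subTyp A B n h h' => exact .subTyp A B n h h'
  | auxtc A h =>
    intro n hne
    have hproto := hp n A h hne
    refine ⟨Set.singleton_nonempty _, Set.singleton_subset_iff.2 hproto.1, ?_⟩
    rintro d n (_ | _)
    rename_i B _ hB
    exact Set.singleton_subset_iff.2 ((hproto.2 _ hB).resolve_left (not_not.2 hproto.1))

theorem QueryFact.isTrue {M : Prop} (hx : M → x ∈ I.ext C) {a : Atom NC NR NI}
    (h : QueryFact C D a) : IsTrue K C I x p M a := by
  cases h with
  | cls E _ => exact (indDen_nameOf C I x p E).trans (clsDen_nameOf C I x E).symm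
  | top _ => rfl
  | bot _ => rfl
  | interLeft E F _ =>
    simp only [IsTrue, clsDen_nameOf]
    exact Set.inter_subset_left
  | interRight E F _ =>
    simp only [IsTrue, clsDen_nameOf]
    exact Set.inter_subset_right
  | inter E F _ =>
    simp only [IsTrue, clsDen_nameOf]
    exact subset_rfl
  | exSub r F _ =>
    simp only [IsTrue, clsDen_nameOf]
    exact fun a b hab hb => ⟨b, hab, hb⟩
  | exSup r F _ =>
    simp only [IsTrue, clsDen_nameOf]
    exact ⟨subset_rfl, fun a ⟨b, hab, hb⟩ => ⟨b, hb, hab⟩⟩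
  | qcls => rfl
  | qSub =>
    simp only [IsTrue, clsDen_nameOf]
    exact subset_rfl
  | qSup =>
    simp only [IsTrue, clsDen_nameOf]
    exact subset_rfl
  | auxtc =>
    refine fun n _ => ⟨Set.singleton_nonempty _, Set.singleton_subset_iff.2 (hx n), ?_⟩
    -- `qcls` never has a `subTyp` fact, so rule (d) forces no typical property on `auxC` through
    -- it.
    rintro d n (_ | _)
  | nom => exact ⟨_, rfl, rfl⟩
  | inst => exact fun n => ⟨Set.singleton_nonempty _, Set.singleton_subset_iff.2 (hx n)⟩

/-- Prototypes justify rules (b) to (d), and the choices in `W` are sound by `hW`. Under `M = False`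
only the rules for subclass checking retain content. -/
theorem isTrue_closedUnder {M : Prop} {W : Set (Atom NC NR NI)} (hI : I.SatTBox K.strict)
    (hA : ∀ α ∈ K.abox, I.SatAssertion α) (hx : M → x ∈ I.ext C)
    (hp : M → ∀ A, .atom A ∈ K.dist → (I.con A).Nonempty → K.IsPrototype I (.atom A) (p A))
    (hW : M → ∀ d, .inst .auxC d ∈ W → x ∈ clsDen C I x d) :
    ClosedUnder (positivePart (baseProgram K C D) W) {a | IsTrue K C I x p M a} := by
  rintro ⟨a, body⟩ ⟨ρ, hρ, rfl, hh⟩ hb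
  change IsTrue K C I x p M a
  change ∀ b ∈ ρ.pos, IsTrue K C I x p M b at hb
  rcases hρ with hρ | hρ | ⟨a', ha', rfl⟩
  · cases hρ <;> simp only [Rule.fact, Rule.definite, Head.atom.injEq, reduceCtorEq, false_and,
      or_false] at hh <;> subst hh
    case fact h => exact h.isTrue hI hA hp
    all_goals trivial
  · cases hρ with
    | inst ρ h => exact h.isTrue (fun _ _ => rfl) (fun _ _ _ => rfl) hb (hh.imp id And.left)
    | sc q ρ h => exact h.isTrue (fun _ _ => rfl) (fun _ _ _ => rfl) hb (hh.imp id And.left)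
    | constraint z u => simp at hh
    | scInit q =>
      simp only [Rule.definite, Head.atom.injEq, reduceCtorEq, false_and, or_false] at hh
      subst hh
      have h : indDen C I x p q = clsDen C I x q := hb (.cls q) (by simp [Rule.definite])
      exact fun n => ⟨by rwa [h], h.subset⟩
    | morespec c d =>
      simp only [Head.atom.injEq, reduceCtorEq, false_and, or_false] at hh
      subst hh
      trivial
    | a c d =>
      simp only [Head.choice.injEq, reduceCtorEq, false_or] at hh
      obtain ⟨rfl, hw⟩ := hh
      exact fun n => ⟨Set.singleton_nonempty _, Set.singleton_subset_iff.2 (hW n d hw)⟩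
    | b y z c =>
      simp only [Rule.definite, Head.atom.injEq, reduceCtorEq, false_and, or_false] at hh
      subst hh
      simp only [Rule.definite, List.forall_mem_cons] at hb
      obtain ⟨h₁, h₂, -⟩ := hb
      intro n
      have := h₁ n ((h₂ n).1.mono (h₂ n).2)
      exact ⟨this.1, this.2.1⟩
    | c y c =>
      simp only [Rule.definite, Head.atom.injEq, reduceCtorEq, false_and, or_false] at hh
      subst hh
      simp only [Rule.definite, List.forall_mem_cons] at hb
      obtain ⟨h₁, h₂, -⟩ := hb
      intro n
      have := h₁ n ((h₂ n).1.mono (h₂ n).2)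
      exact ⟨this.1, this.2.2⟩
    | d y c d m =>
      simp only [Rule.definite, Head.atom.injEq, reduceCtorEq, false_and, or_false] at hh
      subst hh
      simp only [Rule.definite, List.forall_mem_cons] at hb
      obtain ⟨h₁, h₂, -⟩ := hb
      exact fun n => ⟨(h₂ n).1, (h₂ n).2 d m h₁⟩
  · simp only [Rule.fact, Head.atom.injEq, reduceCtorEq, false_and, or_false] at hh
    subst hh
    exact ha'.isTrue hx

end Soundness

/-! ## Existence of answer sets -/

section Existence

variable {K : RankedKB NC NR NI} {C D : Concept NC NR}

theorem baseProgram_head_of_neg {ρ : Rule (Atom NC NR NI)} (hρ : ρ ∈ baseProgram K C D)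
    (h : ρ.neg ≠ []) : ∃ a ∈ {a | ∃ c d, a = Atom.morespec c d}, ρ.head = .atom a := by
  rcases hρ with hρ | hρ | ⟨a', ha', rfl⟩
  · cases hρ <;> exact absurd rfl h
  · cases hρ with
    | inst ρ h' => cases h' <;> exact absurd rfl h
    | sc q ρ h' => cases h' <;> exact absurd rfl h
    | morespec c d => exact ⟨_, ⟨c, d, rfl⟩, rfl⟩
    | _ => exact absurd rfl h
  · exact absurd rfl h

theorem baseProgram_morespec {ρ : Rule (Atom NC NR NI)} (hρ : ρ ∈ baseProgram K C D)
    (a : Atom NC NR NI) (ha : a ∈ {a | ∃ c d, a = Atom.morespec c d}) :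
    (ρ.head = .atom a → ρ.neg ≠ []) ∧ ρ.head ≠ .choice a ∧ a ∉ ρ.pos ∧ a ∉ ρ.neg := by
  obtain ⟨c, d, rfl⟩ := ha
  rcases hρ with hρ | hρ | ⟨a', ha', rfl⟩
  · cases hρ with
    | fact a h =>
      refine ⟨fun h' => ?_, by simp [Rule.fact]⟩
      cases h'
      cases h
    | _ => simp [Rule.definite]
  · cases hρ with
    | inst ρ h' => cases h' <;> simp [Rule.definite]
    | sc q ρ h' => cases h' <;> simp [Rule.definite]
    | _ => simp [Rule.definite]
  · refine ⟨fun h' => ?_, by simp [Rule.fact]⟩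
    cases h'
    cases ha'

/-- The choices of typical properties made by the element `x` of `I`. -/
def choicesOf (C : Concept NC NR) (I : Interpretation NC NR NI Δ) (x : Δ) : Set (Atom NC NR NI) :=
  {a | ∃ d, a = .inst .auxC d ∧ x ∈ clsDen C I x d}

/-- Each instance `x` of `C` in a `T`-compliant model determines an answer set in which only properties
of `x` are derived for `auxC`, and which contains the generated properties of `x`. -/
theorem exists_answerSet {I : Interpretation NC NR NI Δ}
    (hA : ∀ α ∈ K.abox, I.SatAssertion α) (hT : K.IsTCompliant I) {x : Δ} (hx : x ∈ I.ext C) :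
    ∃ S, IsAnswerSet (baseProgram K C D) S ∧ (∀ d, .inst .auxC d ∈ S → x ∈ clsDen C I x d) ∧
      ∀ c d, .dcls c ∈ S → .inst .auxC c ∈ S → .tprop c d ∈ S → x ∈ clsDen C I x d →
        .inst .auxC d ∈ S := by
  classical
  have hex : ∀ A, ∃ y, .atom A ∈ K.dist → (I.con A).Nonempty → K.IsPrototype I (.atom A) y := by
    intro A
    by_cases h : .atom A ∈ K.dist ∧ (I.con A).Nonempty
    · obtain ⟨y, hy⟩ := hT.2 _ h.1 h.2
      exact ⟨y, fun _ _ => hy⟩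
    · exact ⟨x, fun h₁ h₂ => absurd ⟨h₁, h₂⟩ h⟩
  choose p hp using hex
  have hsub : stratifiedModel (baseProgram K C D) (choicesOf C I x) ⊆
      {a | IsTrue K C I x p True a} := by
    refine stratifiedModel_subset (isTrue_closedUnder hT.1 hA (fun _ => hx) (fun _ => hp) ?_)
    rintro - d ⟨_, h, h'⟩
    cases h
    exact h'
  refine ⟨_, isAnswerSet_stratifiedModel (fun ρ hρ => baseProgram_head_of_neg hρ)
    (fun ρ hρ => baseProgram_morespec hρ) ?_, fun d h => (hsub h trivial).2 rfl, ?_⟩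
  · intro ρ hρ hh hb
    rcases hρ with hρ | hρ | ⟨a', ha', rfl⟩
    · cases hρ <;> simp [Rule.fact, Rule.definite] at hh
    · cases hρ with
      | inst ρ h' => cases h' <;> simp [Rule.definite] at hh
      | sc q ρ h' => cases h' <;> simp [Rule.definite] at hh
      | constraint z u =>
        simp only [List.forall_mem_cons] at hb
        have h₁ : clsDen C I x z = ∅ := hsub hb.1
        obtain ⟨⟨a, ha⟩, h⟩ := hsub hb.2.1 trivial
        exact absurd (h ha) (by rw [h₁]; exact id)
      | _ => simp [Rule.definite] at hh
    · simp [Rule.fact] at hh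
  · intro c d h₁ h₂ h₃ h₄
    refine choice_mem_stratifiedModel (fun ρ hρ => baseProgram_head_of_neg hρ)
      (.inr (.inl (.a c d))) ⟨d, rfl, h₄⟩ ?_
    simp [h₁, h₂, h₃]

end Existence

/-! ## The model given by a materialization -/

/-- `S` contains the input facts, is closed under the rules of the calculus for `i` and `t`, and has no
instance of an empty class. -/
structure Materializes (K : RankedKB NC NR NI) (C D : Concept NC NR) (S : Set (Atom NC NR NI))
    (g : List (Atom NC NR NI)) (i : Const NC NR NI → Const NC NR NI → Atom NC NR NI)
    (t : Const NC NR NI → NR → Const NC NR NI → Atom NC NR NI) : Prop where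
  kb : ∀ a, KBFact K a → a ∈ S
  query : ∀ a, QueryFact C D a → a ∈ S
  guard : ∀ b ∈ g, b ∈ S
  closed : ∀ a body, CalcRule g i t (.definite a body) → (∀ b ∈ body, b ∈ S) → a ∈ S
  consistent : ∀ z u, .bot z ∈ S → i u z ∉ S

section Materialization

variable {K : RankedKB NC NR NI} {C D : Concept NC NR} {S : Set (Atom NC NR NI)}
  {g : List (Atom NC NR NI)} {i : Const NC NR NI → Const NC NR NI → Atom NC NR NI}
  {t : Const NC NR NI → NR → Const NC NR NI → Atom NC NR NI}

theorem Materializes.ind_mem (h : Materializes K C D S g i t) (a : NI) :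
    i (.ind a) (.ind a) ∈ S :=
  h.closed _ _ (.r1 _) (by
    simp only [List.forall_mem_cons]
    exact ⟨h.kb _ (.nom a), h.guard⟩)

/-- The interpretation whose elements are the constants with an instance atom. -/
def Materializes.interp (h : Materializes K C D S g i t) :
    Interpretation NC NR NI {c // ∃ z, i c z ∈ S} where
  con A := {c | i c (.cls A) ∈ S}
  role r c d := t c r d ∈ S
  ind a := ⟨.ind a, .ind a, h.ind_mem a⟩

/-- Each normal form is matched by one rule of the calculus, except `⊑ ∃r.B`, which takes `r9` and
`r10`, and `⊑ ⊥`, which is the consistency condition. -/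
theorem Materializes.satTBox (h : Materializes K C D S g i t) (hK : K.Normalized) :
    h.interp.SatTBox K.strict := by
  intro α hα
  cases hK.strict α hα with
  | top A =>
    rintro ⟨c, z, hz⟩ -
    exact h.closed _ _ (.r3 c (.cls A) z) (by simp [hz, h.kb _ (.top A hα)])
  | bot A => exact fun c hc => absurd hc (h.consistent _ _ (h.kb _ (.bot A hα)))
  | sub A B =>
    intro c hc
    refine h.closed _ _ (.r5 c.1 (.cls A) (.cls B)) ?_
    simp only [List.forall_mem_cons]
    exact ⟨h.kb _ (.sub A B hα), hc, by simp⟩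
  | conj A B B' =>
    intro c hc
    refine h.closed _ _ (.r6 c.1 (.cls A) (.cls B) (.cls B')) ?_
    simp only [List.forall_mem_cons]
    exact ⟨h.kb _ (.conj A B B' hα), hc.1, hc.2, by simp⟩
  | exLeft r A B =>
    rintro c ⟨d, hr, hd⟩
    refine h.closed _ _ (.r7 c.1 d.1 (.cls A) (.cls B) r) ?_
    simp only [List.forall_mem_cons]
    exact ⟨h.kb _ (.exLeft r A B hα), hr, hd, by simp⟩
  | exRight A r B =>
    intro c hc
    have hb : ∀ b ∈ [.supEx (.cls A) r (.cls B) (.wit (.atom A) r (.atom B)), i c.1 (.cls A)],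
        b ∈ S := by
      simp only [List.forall_mem_cons]
      exact ⟨h.kb _ (.exRight A r B hα), hc, by simp⟩
    -- All instances of `A` share this witness; `r10` gives it an instance atom, which makes it an
    -- element of the domain.
    have h₁ := h.closed _ _ (.r10 c.1 (.wit (.atom A) r (.atom B)) (.cls A) (.cls B) r) hb
    exact ⟨⟨_, _, h₁⟩, h.closed _ _ (.r9 c.1 (.wit (.atom A) r (.atom B)) (.cls A) (.cls B) r) hb, h₁⟩
  | role r t' =>
    intro c d hr
    refine h.closed _ _ (.r13 c.1 d.1 r t') ?_
    simp only [List.forall_mem_cons]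
    exact ⟨h.kb _ (.role r t' hα), hr, by simp⟩
  | chain r s t' =>
    rintro c d ⟨e, hr, hs⟩
    refine h.closed _ _ (.r15 c.1 e.1 d.1 r s t') ?_
    simp only [List.forall_mem_cons]
    exact ⟨h.kb _ (.chain r s t' hα), hr, hs, by simp⟩

theorem Materializes.satAssertion (h : Materializes K C D S g i t) (hK : K.Normalized)
    (α : Assertion NC NR NI) (hα : α ∈ K.abox) : h.interp.SatAssertion α := by
  cases hK.abox α hα with
  | concept A a =>
    refine h.closed _ _ (.r5 (.ind a) (.ind a) (.cls A)) ?_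
    simp only [List.forall_mem_cons]
    exact ⟨h.kb _ (.assertC A a hα), h.ind_mem a, by simp⟩
  | role r a b =>
    refine h.closed _ _ (.r9 (.ind a) (.ind b) (.ind a) (.ind b) r) ?_
    simp only [List.forall_mem_cons]
    exact ⟨h.kb _ (.assertR r a b hα), h.ind_mem a, by simp⟩

/-- The query axioms define each name in both directions, which gives the equivalence by induction
on subconcepts. -/
theorem Materializes.mem_ext_iff (h : Materializes K C D S g i t) {E : Concept NC NR}
    (hE : E.subs ⊆ C.subs ∪ D.subs) (c : {c // ∃ z, i c z ∈ S}) :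
    c ∈ h.interp.ext E ↔ i c (nameOf E) ∈ S := by
  have hm := hE E.mem_subs_self
  induction E generalizing c with
  | atom A => exact Iff.rfl
  | top =>
    refine iff_of_true trivial ?_
    obtain ⟨c, z, hz⟩ := c
    exact h.closed _ _ (.r3 c (nameOf .top) z) (by simp [hz, h.query _ (.top hm)])
  | bot => exact iff_of_false id (h.consistent _ _ (h.query _ (.bot hm)))
  | inter E F iE iF =>
    have hE' : E.subs ⊆ C.subs ∪ D.subs := fun G hG => hE (.inr (.inl hG))
    have hF' : F.subs ⊆ C.subs ∪ D.subs := fun G hG => hE (.inr (.inr hG))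
    refine (and_congr (iE hE' c (hE' E.mem_subs_self)) (iF hF' c (hF' F.mem_subs_self))).trans
      ⟨fun hc => ?_, fun hc => ⟨?_, ?_⟩⟩
    · exact h.closed _ _ (.r6 c.1 (nameOf E) (nameOf F) (nameOf (.inter E F)))
        (by simpa [h.query _ (.inter E F hm)] using hc)
    · exact h.closed _ _ (.r5 c.1 (nameOf (.inter E F)) (nameOf E))
        (by simpa [h.query _ (.interLeft E F hm)] using hc)
    · exact h.closed _ _ (.r5 c.1 (nameOf (.inter E F)) (nameOf F))
        (by simpa [h.query _ (.interRight E F hm)] using hc)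
  | ex r E iE =>
    have hE' : E.subs ⊆ C.subs ∪ D.subs := fun G hG => hE (.inr hG)
    have iE := fun d => iE hE' d (hE' E.mem_subs_self)
    constructor
    · rintro ⟨d, hr, hd⟩
      refine h.closed _ _ (.r7 c.1 d.1 (nameOf E) (nameOf (.ex r E)) r) ?_
      simp only [List.forall_mem_cons]
      exact ⟨h.query _ (.exSub r E hm), hr, (iE d).1 hd, by simp⟩
    · intro hc
      have hb : ∀ b ∈ [.supEx (nameOf (.ex r E)) r (nameOf E) (.wit (.ex r E) r E),
          i c.1 (nameOf (.ex r E))], b ∈ S := by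
        simp only [List.forall_mem_cons]
        exact ⟨h.query _ (.exSup r E hm), hc, by simp⟩
      have h₁ := h.closed _ _ (.r10 c.1 (.wit (.ex r E) r E) (nameOf (.ex r E)) (nameOf E) r) hb
      exact ⟨⟨_, _, h₁⟩, h.closed _ _ (.r9 c.1 (.wit (.ex r E) r E) (nameOf (.ex r E)) (nameOf E) r) hb,
        (iE _).2 h₁⟩

end Materialization

/-! ## Properties of answer sets of the base program -/

section AnswerSets

variable {K : RankedKB NC NR NI} {C D : Concept NC NR} {S : Set (Atom NC NR NI)}

theorem IsAnswerSet.kbFact_mem (hS : IsAnswerSet (baseProgram K C D) S) {a : Atom NC NR NI}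
    (ha : KBFact K a) : a ∈ S :=
  hS.fact_mem (.inl (.fact a ha))

theorem IsAnswerSet.queryFact_mem (hS : IsAnswerSet (baseProgram K C D) S) {a : Atom NC NR NI}
    (ha : QueryFact C D a) : a ∈ S :=
  hS.fact_mem (.inr (.inr ⟨a, ha, rfl⟩))

theorem IsAnswerSet.irRule_mem (hS : IsAnswerSet (baseProgram K C D) S) {a : Atom NC NR NI}
    {body : List (Atom NC NR NI)} (h : IRRule (.definite a body)) (hb : ∀ b ∈ body, b ∈ S) : a ∈ S :=
  hS.definite_mem (.inr (.inl h)) hb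

theorem IsAnswerSet.materializes (hS : IsAnswerSet (baseProgram K C D) S) :
    Materializes K C D S [] .inst .triple where
  kb _ := hS.kbFact_mem
  query _ := hS.queryFact_mem
  guard := by simp
  closed a body h hb := hS.irRule_mem (.inst _ h) hb
  consistent z u hz hu := hS.2 _ (.inr (.inl (.constraint z u))) rfl (by simp [hz, hu])

theorem IsAnswerSet.auxC_mem (hS : IsAnswerSet (baseProgram K C D) S) :
    ∃ z, Atom.inst .auxC z ∈ S :=
  ⟨.qcls, hS.queryFact_mem .inst⟩

theorem IsAnswerSet.inst_auxC_nameOf (hS : IsAnswerSet (baseProgram K C D) S) :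
    Atom.inst .auxC (nameOf C) ∈ S :=
  hS.irRule_mem (.inst _ (.r5 _ .qcls _))
    (by simp [hS.queryFact_mem .qSub, hS.queryFact_mem (C := C) (D := D) .inst])

theorem IsAnswerSet.inst_typAux (hS : IsAnswerSet (baseProgram K C D) S) {A : NC}
    (hA : .atom A ∈ K.dist) {c : Const NC NR NI} (hc : .inst c (.cls A) ∈ S) :
    .inst (.typAux A) (.cls A) ∈ S :=
  hS.irRule_mem (.b c _ _) (by simp [hc, hS.kbFact_mem (.auxtc A hA)])

theorem IsAnswerSet.inst_typAux_typ (hS : IsAnswerSet (baseProgram K C D) S) {A B : NC} {n : ℕ}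
    (hA : .atom A ∈ K.dist) (hB : (Concept.atom B, n) ∈ K.typ (.atom A))
    (h : .inst (.typAux A) (.cls A) ∈ S) : .inst (.typAux A) (.cls B) ∈ S := by
  have h' : .typ (.typAux A) (.cls A) ∈ S :=
    hS.irRule_mem (.c _ _) (by simp [h, hS.kbFact_mem (.auxtc A hA)])
  exact hS.irRule_mem (.d _ (.cls A) _ n) (by simp [h', hS.kbFact_mem (.subTyp A B n hA hB)])

/-- Rule (b) makes `typAux A` an instance of `A` as soon as there is one, and rules (c) and (d) give
it all typical properties. -/
theorem IsAnswerSet.isTCompliant (hK : K.Normalized) (hS : IsAnswerSet (baseProgram K C D) S) :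
    K.IsTCompliant hS.materializes.interp := by
  refine ⟨hS.materializes.satTBox hK, fun E hE => ?_⟩
  obtain ⟨A, rfl⟩ := hK.dist E hE
  rintro ⟨c, hc⟩
  have h := hS.inst_typAux hE hc
  refine ⟨⟨_, _, h⟩, h, fun q hq => .inr ?_⟩
  obtain ⟨B, hB⟩ := hK.typ _ hE q hq
  obtain ⟨_, n⟩ := q
  cases hB
  exact hS.inst_typAux_typ hE hq h

/-- Atoms of an answer set are supported, and only input facts have such a head; this part is thus
the same in all answer sets. -/
theorem IsAnswerSet.subTyp_iff (hS : IsAnswerSet (baseProgram K C D) S) {c d : Const NC NR NI}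
    {n : ℕ} : .subTyp c d n ∈ S ↔ ∃ A B, c = .cls A ∧ d = .cls B ∧ .atom A ∈ K.dist ∧
      (Concept.atom B, n) ∈ K.typ (.atom A) := by
  constructor
  · intro h
    obtain ⟨ρ, hρ | hρ | ⟨a, ha, rfl⟩, hh, -⟩ := hS.supported h
    · cases hρ with
      | fact a hf =>
        simp only [Rule.fact, Head.atom.injEq, reduceCtorEq, or_false] at hh
        subst hh
        cases hf with
        | subTyp A B n hA hB => exact ⟨A, B, rfl, rfl, hA, hB⟩
      | _ => simp [Rule.definite] at hh
    · cases hρ with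
      | inst ρ h' => cases h' <;> simp [Rule.definite] at hh
      | sc q ρ h' => cases h' <;> simp [Rule.definite] at hh
      | _ => simp [Rule.definite] at hh
    · simp only [Rule.fact, Head.atom.injEq, reduceCtorEq, or_false] at hh
      subst hh
      cases ha
  · rintro ⟨A, B, rfl, rfl, h, h'⟩
    exact hS.kbFact_mem (.subTyp A B n h h')

theorem IsAnswerSet.dcls_iff (hS : IsAnswerSet (baseProgram K C D) S) {c : Const NC NR NI} :
    .dcls c ∈ S ↔ ∃ d n, .subTyp c d n ∈ S := by
  constructor
  · intro h
    obtain ⟨ρ, hρ | hρ | ⟨a, ha, rfl⟩, hh, hp, -⟩ := hS.supported h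
    · cases hρ with
      | fact a h =>
        simp only [Rule.fact, Head.atom.injEq, reduceCtorEq, or_false] at hh
        subst hh
        cases h
      | dcls c d n =>
        simp only [Rule.definite, Head.atom.injEq, Atom.dcls.injEq, reduceCtorEq, or_false] at hh
        subst hh
        exact ⟨d, n, hp _ (by simp [Rule.definite])⟩
      | _ => simp [Rule.definite] at hh
    · cases hρ with
      | inst ρ h' => cases h' <;> simp [Rule.definite] at hh
      | sc q ρ h' => cases h' <;> simp [Rule.definite] at hh
      | _ => simp [Rule.definite] at hh
    · simp only [Rule.fact, Head.atom.injEq, reduceCtorEq, or_false] at hh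
      subst hh
      cases ha
  · rintro ⟨d, n, h⟩
    exact hS.definite_mem (.inl (.dcls c d n)) (by simp [h])

theorem IsAnswerSet.validrank_iff (hS : IsAnswerSet (baseProgram K C D) S) {c : Const NC NR NI}
    {n : ℕ} : .validrank c n ∈ S ↔ ∃ d, .subTyp c d n ∈ S := by
  constructor
  · intro h
    obtain ⟨ρ, hρ | hρ | ⟨a, ha, rfl⟩, hh, hp, -⟩ := hS.supported h
    · cases hρ with
      | fact a h =>
        simp only [Rule.fact, Head.atom.injEq, reduceCtorEq, or_false] at hh
        subst hh
        cases h
      | validrank c d n =>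
        simp only [Rule.definite, Head.atom.injEq, Atom.validrank.injEq, reduceCtorEq,
          or_false] at hh
        obtain ⟨rfl, rfl⟩ := hh
        exact ⟨d, hp _ (by simp [Rule.definite])⟩
      | _ => simp [Rule.definite] at hh
    · cases hρ with
      | inst ρ h' => cases h' <;> simp [Rule.definite] at hh
      | sc q ρ h' => cases h' <;> simp [Rule.definite] at hh
      | _ => simp [Rule.definite] at hh
    · simp only [Rule.fact, Head.atom.injEq, reduceCtorEq, or_false] at hh
      subst hh
      cases ha
  · rintro ⟨d, h⟩
    exact hS.definite_mem (.inl (.validrank c d n)) (by simp [h])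

theorem IsAnswerSet.morespec_iff (hS : IsAnswerSet (baseProgram K C D) S) {c d : Const NC NR NI} :
    .morespec c d ∈ S ↔ .dcls c ∈ S ∧ .dcls d ∈ S ∧ .instSc c d c ∈ S ∧ .instSc d c d ∉ S := by
  constructor
  · intro h
    obtain ⟨ρ, hρ | hρ | ⟨a, ha, rfl⟩, hh, hp, hn⟩ := hS.supported h
    · cases hρ with
      | fact a h =>
        simp only [Rule.fact, Head.atom.injEq, reduceCtorEq, or_false] at hh
        subst hh
        cases h
      | _ => simp [Rule.definite] at hh
    · cases hρ with
      | inst ρ h' => cases h' <;> simp [Rule.definite] at hh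
      | sc q ρ h' => cases h' <;> simp [Rule.definite] at hh
      | morespec c d =>
        simp only [Head.atom.injEq, Atom.morespec.injEq, reduceCtorEq, or_false] at hh
        obtain ⟨rfl, rfl⟩ := hh
        simpa [and_assoc] using And.intro hp hn
      | _ => simp [Rule.definite] at hh
    · simp only [Rule.fact, Head.atom.injEq, reduceCtorEq, or_false] at hh
      subst hh
      cases ha
  · rintro ⟨h₁, h₂, h₃, h₄⟩
    exact hS.1.1 (_, _) ⟨_, .inr (.inl (.morespec c d)), by simp [h₄], rfl, .inl rfl⟩
      (by simp [h₁, h₂, h₃])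

/-- Subclass checking is sound and complete. -/
theorem IsAnswerSet.instSc_iff (hK : K.Normalized) (hS : IsAnswerSet (baseProgram K C D) S)
    (A B : NC) : .instSc (.cls A) (.cls B) (.cls A) ∈ S ↔
      Entails NI (K.strict : Set (Inclusion NC NR)) (.atom A) (.atom B) := by
  have hS' := hS.materializes
  constructor
  · intro h Δ _ J hJ a ha
    -- `J` need not satisfy the ABox, whose facts belong to the program; a disjoint copy of the
    -- materialization supplies a component that does.
    let Δ' : Bool → Type := fun b => match b with
      | true => Δ
      | false => {c // ∃ z, Atom.inst c z ∈ S}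
    let I' : ∀ b, Interpretation NC NR NI (Δ' b) := fun b => match b with
      | true => J
      | false => hS'.interp
    have hI' : ∀ b, (I' b).SatTBox K.strict := fun b => match b with
      | true => hJ
      | false => hS'.satTBox hK
    have hsub := hS.subset_of_closedUnder (isTrue_closedUnder (C := C) (D := D) (M := False)
      (I := Interpretation.sigma I' false) (x := ⟨true, a⟩) (p := fun _ => ⟨true, a⟩)
      (Interpretation.satTBox_sigma I' false hI')
      (fun α hα => Interpretation.satAssertion_sigma I' false (hS'.satAssertion hK α hα))
      False.elim False.elim False.elim)
    have ha' : (⟨true, a⟩ : Σ b, Δ' b) ∈ (Interpretation.sigma I' false).ext (.atom A) := ha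
    exact (hsub h ⟨_, ha'⟩).2 ha'
  · intro h
    by_contra hn
    have hg : .cls (.cls A) ∈ S := hS.kbFact_mem (.cls A)
    have hA : .instSc (.cls A) (.cls A) (.cls A) ∈ S := hS.irRule_mem (.scInit _) (by simp [hg])
    have hm : Materializes K C D S [.cls (.cls A)] (fun c d => .instSc c d (.cls A))
        (fun c r d => .tripleSc c r d (.cls A)) :=
      { kb := fun _ => hS.kbFact_mem
        query := fun _ => hS.queryFact_mem
        guard := by simp [hg]
        closed := fun a body h hb => hS.irRule_mem (.sc _ _ h) hb
        -- If the subclass materialization of `A` contained an instance of an empty class, `r4`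
        -- would derive the missing subsumption.
        consistent := fun z u hz hu => hn (hS.irRule_mem (.sc _ _ (.r4 _ _ z u (.cls A)))
          (by simp [hz, hu, hA, hS.kbFact_mem (.cls B)])) }
    have : Nonempty {c // ∃ z, Atom.instSc c z (.cls A) ∈ S} := ⟨⟨_, _, hA⟩⟩
    exact hn (h _ hm.interp (hm.satTBox hK) (a := ⟨_, _, hA⟩) hA)

/-! ## The preference program -/

/-- The defeasible inclusions satisfied in an answer set. -/
def satisfiedIn (S : Set (Atom NC NR NI)) (A B : NC) : Prop :=
  Atom.inst .auxC (.cls A) ∉ S ∨ Atom.inst .auxC (.cls B) ∈ S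

theorem IsAnswerSet.aggregate_eq (hS : IsAnswerSet (baseProgram K C D) S)
    (S' : Set (Atom NC NR NI)) {A : NC} (hA : .atom A ∈ K.dist) (n : ℕ) :
    aggregate S S' (.cls A) n =
      -(K.count (satisfiedIn S) A n : ℤ) + (K.count (satisfiedIn S') A n : ℤ) := by
  have key : ∀ X, {e | Sat S X (.cls A) e ∧ .subTyp (.cls A) e n ∈ S} =
      Const.cls '' {B : NC | (Concept.atom B, n) ∈ K.typ (.atom A) ∧ satisfiedIn X A B} := by
    intro X
    ext e
    constructor
    · rintro ⟨h₁, h₂⟩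
      obtain ⟨_, B, h, rfl, -, hB⟩ := hS.subTyp_iff.1 h₂
      cases h
      exact ⟨B, ⟨hB, h₁.symm.imp And.left And.left⟩, rfl⟩
    · rintro ⟨B, ⟨hB, h⟩, rfl⟩
      have : .subTyp (.cls A) (.cls B) n ∈ S := hS.subTyp_iff.2 ⟨A, B, rfl, rfl, hA, hB⟩
      exact ⟨h.symm.imp (⟨·, n, this⟩) (⟨·, n, this⟩), this⟩
  have inj : Function.Injective (Const.cls : NC → Const NC NR NI) := fun B B' h => by cases h; rfl
  rw [aggregate, key, key, Set.ncard_image_of_injective _ inj, Set.ncard_image_of_injective _ inj]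
  rfl

theorem IsAnswerSet.count_eq_zero (hS : IsAnswerSet (baseProgram K C D) S) {A : NC}
    (hA : .atom A ∈ K.dist) {n : ℕ} (h : .validrank (.cls A) n ∉ S) (q : NC → NC → Prop) :
    K.count q A n = 0 := by
  refine (Set.ncard_eq_zero (K.finite_count _ A n)).2 (Set.eq_empty_of_forall_notMem fun B hB => h ?_)
  exact hS.validrank_iff.2 ⟨.cls B, hS.subTyp_iff.2 ⟨A, B, rfl, rfl, hA, hB.1⟩⟩

theorem IsAnswerSet.dcls_of_validrank (hS : IsAnswerSet (baseProgram K C D) S)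
    {c : Const NC NR NI} {n : ℕ} (h : .validrank c n ∈ S) : .dcls c ∈ S := by
  obtain ⟨d, hd⟩ := hS.validrank_iff.1 h
  exact hS.dcls_iff.2 ⟨d, n, hd⟩

theorem IsAnswerSet.sameNumProp_iff (hS : IsAnswerSet (baseProgram K C D) S)
    (S' : Set (Atom NC NR NI)) {A : NC} (hA : .atom A ∈ K.dist) (n : ℕ) :
    (.validrank (.cls A) n ∈ S → SameNumProp S S' (.cls A) n) ↔
      K.count (satisfiedIn S) A n = K.count (satisfiedIn S') A n := by
  by_cases h : .validrank (.cls A) n ∈ S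
  · simp only [SameNumProp, h, hS.aggregate_eq S' hA, true_and, forall_const]
    omega
  · simp [h, hS.count_eq_zero hA h]

theorem IsAnswerSet.betterWrt_iff (hS : IsAnswerSet (baseProgram K C D) S)
    (S' : Set (Atom NC NR NI)) {A : NC} (hA : .atom A ∈ K.dist) :
    BetterWrt S S' (.cls A) ↔ LexGT (K.count (satisfiedIn S) A) (K.count (satisfiedIn S') A) := by
  constructor
  · rintro ⟨-, n, ⟨hv, hn⟩, h⟩
    rw [hS.aggregate_eq S' hA] at hn
    exact ⟨n, by omega, fun m hm => (hS.sameNumProp_iff S' hA m).1 fun h' => h m h' hm⟩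
  · rintro ⟨n, hn, h⟩
    have hv : .validrank (.cls A) n ∈ S := by
      by_contra hc
      simp [hS.count_eq_zero hA hc] at hn
    refine ⟨hS.dcls_of_validrank hv, n, ⟨hv, ?_⟩, fun m hv hm =>
      (hS.sameNumProp_iff S' hA m).2 (h m hm) hv⟩
    rw [hS.aggregate_eq S' hA]
    omega

theorem IsAnswerSet.betterEqWrt_iff (hS : IsAnswerSet (baseProgram K C D) S)
    (S' : Set (Atom NC NR NI)) {A : NC} (hA : .atom A ∈ K.dist) (hd : .dcls (.cls A) ∈ S) :
    BetterEqWrt S S' (.cls A) ↔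
      ¬ LexGT (K.count (satisfiedIn S') A) (K.count (satisfiedIn S) A) := by
  rw [LexGT.not_iff (K.bounded_count _ _) (K.bounded_count _ _), or_comm,
    ← hS.betterWrt_iff S' hA, BetterEqWrt, funext_iff]
  simp only [hd, true_and, hS.sameNumProp_iff S' hA]

theorem IsAnswerSet.exists_atom_of_dcls (hS : IsAnswerSet (baseProgram K C D) S)
    {c : Const NC NR NI} (hc : .dcls c ∈ S) : ∃ A, c = .cls A ∧ .atom A ∈ K.dist := by
  obtain ⟨d, n, h⟩ := hS.dcls_iff.1 hc
  obtain ⟨A, B, rfl, -, hA, -⟩ := hS.subTyp_iff.1 h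
  exact ⟨A, rfl, hA⟩

/-- The aggregates are differences of counts, and ranks that are not `validrank` contribute zero on
both sides. -/
theorem IsAnswerSet.better_iff (hK : K.Normalized) (hS : IsAnswerSet (baseProgram K C D) S)
    (S' : Set (Atom NC NR NI)) : Better S S' ↔ K.Preferred (satisfiedIn S) (satisfiedIn S') := by
  constructor
  · rintro ⟨c, hc, hb, h⟩
    obtain ⟨A, rfl, hA⟩ := hS.exists_atom_of_dcls hc
    refine ⟨⟨A, hA, (hS.betterWrt_iff S' hA).1 hb⟩, fun B hB => ?_⟩
    by_cases hd : .dcls (.cls B) ∈ S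
    · rcases h _ hd with ⟨-, h⟩ | ⟨e, -, he, hm, h⟩
      · exact .inl ((hS.betterEqWrt_iff S' hB hd).1 h)
      · obtain ⟨H, rfl, hH⟩ := hS.exists_atom_of_dcls he
        rw [hS.morespec_iff, hS.instSc_iff hK, hS.instSc_iff hK] at hm
        exact .inr ⟨H, hH, hm.2.2, (hS.betterWrt_iff S' hH).1 h⟩
    -- A distinguished concept without `dcls` has no defeasible inclusions; its counts vanish and it
    -- cannot attack.
    · left
      rintro ⟨n, hn, -⟩
      simp [hS.count_eq_zero hB (fun h => hd (hS.dcls_of_validrank h))] at hn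
  · rintro ⟨⟨A, hA, h₁⟩, h₂⟩
    have hb := (hS.betterWrt_iff S' hA).2 h₁
    refine ⟨_, hb.1, hb, fun d hd => ?_⟩
    obtain ⟨B, rfl, hB⟩ := hS.exists_atom_of_dcls hd
    rcases h₂ B hB with h | ⟨H, hH, hm, h⟩
    · exact .inl ⟨hd, (hS.betterEqWrt_iff S' hB hd).2 h⟩
    · have hb := (hS.betterWrt_iff S' hH).2 h
      refine .inr ⟨_, hd, hb.1, hS.morespec_iff.2 ⟨hb.1, hd, ?_⟩, hb⟩
      rw [hS.instSc_iff hK, hS.instSc_iff hK]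
      exact hm

/-- The element `auxC` of the model given by an answer set. -/
def auxElem (hS : IsAnswerSet (baseProgram K C D) S) : {c // ∃ z, Atom.inst c z ∈ S} :=
  ⟨.auxC, hS.auxC_mem⟩

theorem IsAnswerSet.mem_ext_left (hS : IsAnswerSet (baseProgram K C D) S) :
    auxElem hS ∈ hS.materializes.interp.ext C :=
  (hS.materializes.mem_ext_iff Set.subset_union_left _).2 hS.inst_auxC_nameOf

theorem IsAnswerSet.mem_ext_right_iff (hS : IsAnswerSet (baseProgram K C D) S) :
    auxElem hS ∈ hS.materializes.interp.ext D ↔ .inst .auxC (nameOf D) ∈ S :=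
  hS.materializes.mem_ext_iff Set.subset_union_right _

/-- An element with the type of `auxC` satisfies the same defeasible inclusions. -/
theorem IsAnswerSet.satisfied_iff (hS : IsAnswerSet (baseProgram K C D) S)
    {I : Interpretation NC NR NI Δ} {x : Δ}
    (h : ∀ E ∈ K.occurring, (x ∈ I.ext E ↔ auxElem hS ∈ hS.materializes.interp.ext E)) {A B : NC}
    {l : ℕ} (hA : .atom A ∈ K.dist) (hB : (Concept.atom B, l) ∈ K.typ (.atom A)) :
    I.satisfied x A B ↔ satisfiedIn S A B :=
  or_congr (not_congr (h _ (K.dist_subset_occurring hA))) (h _ (K.typ_subset_occurring hA hB))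

/-- An instance of `C` in a `T`-compliant model determines an answer set that satisfies at least the same
defeasible inclusions. -/
theorem exists_answerSet_satisfiedIn {I : Interpretation NC NR NI Δ}
    (hA : ∀ α ∈ K.abox, I.SatAssertion α) (hT : K.IsTCompliant I) {x : Δ} (hx : x ∈ I.ext C) :
    ∃ S, IsAnswerSet (baseProgram K C D) S ∧ (.inst .auxC (nameOf D) ∈ S → x ∈ I.ext D) ∧
      ∀ A B l, .atom A ∈ K.dist → (Concept.atom B, l) ∈ K.typ (.atom A) → I.satisfied x A B →
        satisfiedIn S A B := by
  obtain ⟨S, hS, h₁, h₂⟩ := exists_answerSet (D := D) hA hT hx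
  refine ⟨S, hS, fun h => clsDen_nameOf C I x D ▸ h₁ _ h, fun A B l hA hB h => ?_⟩
  rw [satisfiedIn, or_iff_not_imp_left, not_not]
  intro hm
  have hs : .subTyp (.cls A) (.cls B) l ∈ S := hS.subTyp_iff.2 ⟨A, B, rfl, rfl, hA, hB⟩
  exact h₂ _ _ (hS.dcls_iff.2 ⟨_, _, hs⟩) hm
    (hS.definite_mem (.inl (.tprop _ _ l)) (by simp [hs])) (h.resolve_left (not_not.2 (h₁ _ hm)))

end AnswerSets

/-! ## Preferred answer sets and canonical models -/

section Main

variable {K : RankedKB NC NR NI} {C D : Concept NC NR}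

theorem exists_preferred_of_countermodel (hK : K.Normalized) (hC : C.BuiltFrom K.occurring)
    {M : CwmInterpretation K Δ} (hM : M.IsCanonicalTCompliantModel) (h : ¬ M.SatTyp C D) :
    ∃ S, IsPreferredAnswerSet K C D S ∧ Atom.inst .auxC (nameOf D) ∉ S := by
  obtain ⟨x, ⟨hxC, hmin⟩, hxD⟩ := Set.not_subset.1 h
  obtain ⟨S, hS, h₁, h₂⟩ :=
    exists_answerSet_satisfiedIn (D := D) hM.model.abox hM.compliant hxC
  refine ⟨S, ⟨hS, fun S' hS' hb => hmin ?_⟩, fun h => hxD (h₁ h)⟩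
  -- A better answer set would place an instance of `C` with the type of its `auxC` strictly below
  -- `x`.
  obtain ⟨y, hy⟩ := hM.canonical.exists_same_type (hS'.materializes.satTBox hK) (auxElem hS')
  refine ⟨y, (hC.ext_iff hy).2 hS'.mem_ext_left, ?_⟩
  rw [M.lt_iff_preferred hK hM.model.pref]
  exact ((hS'.better_iff hK S).1 hb).mono
    (fun A B l hA hB => (hS'.satisfied_iff hy hA hB).2) h₂

/-- Under `NoConflict`, each `T`-compliant model of the strict part and the ABox can be extended to a
canonical one. -/
theorem exists_canonical_extension (hN : K.NoConflict)
    {I : Interpretation NC NR NI Δ} (hA : ∀ α ∈ K.abox, I.SatAssertion α) (hT : K.IsTCompliant I)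
    (x : Δ) : ∃ (Δ' : Type) (J : Interpretation NC NR NI Δ') (x' : Δ'),
      (∀ α ∈ K.abox, J.SatAssertion α) ∧ K.IsCanonical J ∧ K.IsTCompliant J ∧
      ∀ E, x' ∈ J.ext E ↔ x ∈ I.ext E := by
  classical
  -- One component carries the ABox and `x`, one realizes each consistent list of literals, and one
  -- supplies a prototype for each satisfiable distinguished concept, since new components may
  -- populate concepts that were empty.
  let ι := Option ({L : List (Concept NC NR × Bool) //
    (∀ p ∈ L, p.1 ∈ K.occurring) ∧ K.ConsistentWith L} ⊕
    {E : Concept NC NR // E ∈ K.dist ∧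
      ¬ Entails NI (K.strict : Set (Inclusion NC NR)) E .bot})
  have hmodels : ∀ i : ι, ∃ (Δ' : Type) (J : Interpretation NC NR NI Δ'), J.SatTBox K.strict ∧
      match i with
      | none => ∃ x', (∀ α ∈ K.abox, J.SatAssertion α) ∧ ∀ E, x' ∈ J.ext E ↔ x ∈ I.ext E
      | some (.inl L) => ∃ y, ∀ p ∈ L.1, (p.2 = true → y ∈ J.ext p.1) ∧ (p.2 = false → y ∉ J.ext p.1)
      | some (.inr E) => ∃ y, K.IsPrototype J E.1 y := by
    rintro (_ | L | E)
    · exact ⟨Δ, I, hT.1, x, hA, fun E => Iff.rfl⟩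
    · exact L.2.2.exists_model L.2.1
    · obtain ⟨Δ', -, J, h⟩ := hN E.1 E.2.1 E.2.2
      exact ⟨Δ', J, h⟩
  choose Δ' J hJ hJ' using hmodels
  have hsat := Interpretation.satTBox_sigma J none hJ
  obtain ⟨x', hA', hx'⟩ := hJ' none
  refine ⟨Σ i, Δ' i, Interpretation.sigma J none, ⟨none, x'⟩,
    fun α hα => Interpretation.satAssertion_sigma J none (hA' α hα), ⟨hsat, fun L hL hc => ?_⟩,
    ⟨hsat, fun E hE hne => ?_⟩, fun E => (Interpretation.mem_ext_sigma J none E none x').trans (hx' E)⟩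
  · obtain ⟨y, hy⟩ := hJ' (some (.inl ⟨L, hL, hc⟩))
    exact ⟨⟨_, y⟩, fun p hp => by simpa only [Interpretation.mem_ext_sigma] using hy p hp⟩
  · obtain ⟨d, hd⟩ := hne
    have hc : ¬ Entails NI (K.strict : Set (Inclusion NC NR)) E .bot := fun h =>
      have : Nonempty (Σ i, Δ' i) := ⟨d⟩
      h _ _ hsat hd
    obtain ⟨y, hy⟩ := hJ' (some (.inr ⟨E, hE, hc⟩))
    exact ⟨⟨_, y⟩, RankedKB.isPrototype_of_iff
      (fun E _ => Interpretation.mem_ext_sigma J none E _ y) hE hy⟩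

theorem exists_countermodel_of_preferred (hK : K.Normalized) (hN : K.NoConflict)
    {S : Set (Atom NC NR NI)} (hS : IsPreferredAnswerSet K C D S)
    (h : Atom.inst .auxC (nameOf D) ∉ S) :
    ∃ (Δ : Type) (_ : Finite Δ) (_ : Nonempty Δ) (M : CwmInterpretation K Δ),
      M.IsCanonicalTCompliantModel ∧ ¬ M.SatTyp C D := by
  obtain ⟨hS, hpref⟩ := hS
  obtain ⟨Δ, J, x, hA, hcan, hT, hx⟩ := exists_canonical_extension hN
    (hS.materializes.satAssertion hK) (hS.isTCompliant hK) (auxElem hS)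
  have : Nonempty Δ := ⟨x⟩
  let Γ := K.occurring ∪ (C.subs ∪ D.subs)
  have hCΓ : C ∈ Γ := .inr (.inl C.mem_subs_self)
  have hDΓ : D ∈ Γ := .inr (.inr D.mem_subs_self)
  obtain ⟨Δ', hfin, hne, F, hF, hFA, hreal, hinter⟩ := K.exists_finite_model hcan.1 hA (Γ := Γ)
    (K.finite_occurring.union (C.finite_subs.union D.finite_subs))
    (by
      rintro E (hE | hE | hE)
      · exact (K.subs_subset_occurring hE).trans fun G hG => .inl hG
      · exact (Concept.subs_subset hE).trans fun G hG => .inr (.inl hG)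
      · exact (Concept.subs_subset hE).trans fun G hG => .inr (.inr hG))
    Set.subset_union_left
  have hTF : K.IsTCompliant F := by
    refine ⟨hF, fun E hE ⟨d', hd'⟩ => ?_⟩
    -- An instance of `E` in `F` corresponds to a non-empty set of instances in `J`, so `J` has a
    -- prototype, whose type `F` realizes.
    obtain ⟨X, ⟨d, hd⟩, hX⟩ := hinter d'
    obtain ⟨y, hy⟩ := hT.2 E hE ⟨d, (hX E (.inl (K.dist_subset_occurring hE))).1 hd' hd⟩
    obtain ⟨y', hy'⟩ := hreal y
    exact ⟨y', RankedKB.isPrototype_of_iff (fun E hE => hy' E (.inl hE)) hE hy⟩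
  have hcanF : K.IsCanonical F := by
    refine ⟨hF, fun L hL hc => ?_⟩
    obtain ⟨y, hy⟩ := hcan.2 L hL hc
    obtain ⟨y', hy'⟩ := hreal y
    exact ⟨y', fun p hp => by simpa only [hy' p.1 (.inl (hL p hp))] using hy p hp⟩
  obtain ⟨x', hx'⟩ := hreal x
  have hx'S : ∀ E ∈ Γ, (x' ∈ F.ext E ↔ auxElem hS ∈ hS.materializes.interp.ext E) :=
    fun E hE => (hx' E hE).trans (hx E)
  refine ⟨Δ', hfin, hne, K.toCwm F, ⟨⟨fun _ _ _ _ => Iff.rfl, hF, hFA⟩, hcanF, hTF⟩, fun hsat => ?_⟩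
  refine h (hS.mem_ext_right_iff.1 ((hx'S D hDΓ).1 (hsat ⟨(hx'S C hCΓ).2 hS.mem_ext_left, ?_⟩)))
  rintro ⟨y, hyC, hlt⟩
  -- The answer set determined by `y` satisfies at least the inclusions satisfied by `y`, while `x'`
  -- satisfies exactly those of `S`; it would be better than `S`.
  obtain ⟨S', hS', -, h₂⟩ := exists_answerSet_satisfiedIn (D := D) hFA hTF hyC
  refine hpref S' hS' ((hS'.better_iff hK S).2 ?_)
  exact (((K.toCwm F).lt_iff_preferred hK (fun _ _ _ _ => Iff.rfl) y x').1 hlt).mono h₂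
    fun A B l hA hB => (hS.satisfied_iff (fun E hE => hx'S E (.inl hE)) hA hB).2

end Main

end CwM

theorem proposition3 {NC NR NI : Type} (K : CwM.RankedKB NC NR NI) (hK : K.Normalized)
    (C D : CwM.Concept NC NR) :
    (C.BuiltFrom K.occurring →
      (∃ (Δ : Type) (_ : Finite Δ) (_ : Nonempty Δ) (M : CwM.CwmInterpretation K Δ),
        M.IsCanonicalTCompliantModel ∧ ¬ M.SatTyp C D) →
      ∃ S, CwM.IsPreferredAnswerSet K C D S ∧ CwM.Atom.inst .auxC (CwM.nameOf D) ∉ S) ∧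
    (K.NoConflict →
      (∃ S, CwM.IsPreferredAnswerSet K C D S ∧ CwM.Atom.inst .auxC (CwM.nameOf D) ∉ S) →
      ∃ (Δ : Type) (_ : Finite Δ) (_ : Nonempty Δ) (M : CwM.CwmInterpretation K Δ),
        M.IsCanonicalTCompliantModel ∧ ¬ M.SatTyp C D) ∧
    (C.BuiltFrom K.occurring → K.NoConflict →
      (K.CwmEntails C D ↔
        ∀ S, CwM.IsPreferredAnswerSet K C D S → CwM.Atom.inst .auxC (CwM.nameOf D) ∈ S)) := by
  refine ⟨?_, ?_, fun hC hN => ⟨fun h S hS => ?_, fun h Δ _ _ M hM => ?_⟩⟩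
  · rintro hC ⟨Δ, -, -, M, hM, h⟩
    exact CwM.exists_preferred_of_countermodel hK hC hM h
  · rintro hN ⟨S, hS, h⟩
    exact CwM.exists_countermodel_of_preferred hK hN hS h
  · by_contra hn
    obtain ⟨Δ, _, _, M, hM, h'⟩ := CwM.exists_countermodel_of_preferred hK hN hS hn
    exact h' (h Δ M hM)
  · by_contra hn
    obtain ⟨S, hS, h'⟩ := CwM.exists_preferred_of_countermodel hK hC hM hn
    exact h' (h S hS)
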